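/- Let $K$ be a local field of characteristic $0$ (that is, the completion of a number field at a finite or archimedean place), with normalized absolute value $|y|$ (the module of $t\mapsto yt$; thus $|z|=z\bar z$ on $\mathbb C$). Let $\lambda$ be a non-trivial continuous unitary character of the additive group $K$ (for instance $\lambda(x)=e^{\pm 2\pi i\,\mathrm{Tr}(x)}$), $dy$ the Haar measure that is self-dual for $\lambda$, and $\widetilde\varphi(x)=\int_K\varphi(y)\lambda(-xy)\,dy$ the Fourier transform. Let $A$ be multiplication by $\log|y|$, let $B$ be its Fourier conjugate, i.e. $\widetilde{B\varphi}(x)=\log|x|\,\widetilde\varphi(x)$, and put $H=A+B$, $K_1=[A,H]$ and $K_{N+1}=[A,K_N]$ for $N\ge 1$. These operators are applied to test functions on the punctured line, that is, to Schwartz--Bruhat functions on $K$ that vanish identically in a neighbourhood of the origin. (0) For every continuous unitary character $\chi:K^\times\to U(1)$ and every $s$ with $0<\mathrm{Re}(s)<1$ there is a unique complex number $\Gamma(\chi,s)$ such that $$\int_K\widetilde\varphi(x)\chi(x)|x|^{s-1}\,dx=\Gamma(\chi,s)\int_K\varphi(y)\chi^{-1}(y)|y|^{-s}\,dy$$ for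 all Schwartz--Bruhat functions $\varphi$ (with absolutely convergent integrals); the function $s\mapsto\Gamma(\chi,s)$ is analytic and has no zero in the strip $0<\mathrm{Re}(s)<1$. Moreover, for every $N\ge 1$: (1) For all test functions $\alpha_1,\alpha_2$ on the punctured line, $\int_K K_N(\alpha_1)\,\alpha_2\,dy=(-1)^N\int_K\alpha_1\,K_N(\alpha_2)\,dy$. Accordingly, $K_N(T)$ is defined, for $T(y)=\chi^{-1}(y)|y|^{-s}$, as the distribution $\alpha\mapsto(-1)^N\int_K T(y)\,K_N(\alpha)(y)\,dy$ on the punctured line. (2) For every continuous unitary character $\chi$ of $K^\times$ and every $s$ with $0<\mathrm{Re}(s)<1$, as distributions on the punctured line, $$K_N\big(\chi^{-1}(y)|y|^{-s}\big)=\Big(\frac{\partial^{N+1}}{\partial s^{N+1}}\log\Gamma(\chi,s)\Big)\,\chi^{-1}(y)|y|^{-s};$$ that is, for every test function $\alpha$ on the punctured line, the integral on the left below converges absolutely and $$(-1)^N\int_K K_N(\alpha)(y)\,\chi^{-1}(y)|y|^{-s}\,dy=\Big(\frac{\partial^{N+1}}{\partial s^{N+1}}\log\Gamma(\chi,s)\Big)\int_K\alpha(y)\,\chi^{-1}(y)|y|^{-s}\,dy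 .$$ (3) $K_N$ is bounded: it maps test functions on the punctured line to square-integrable functions, and agrees on them with a bounded operator on $L^2(K,dy)$. -/

import Mathlib

open MeasureTheory Topology

noncomputable section

namespace LocalCommutator

variable {K : Type*} [NontriviallyNormedField K]

/-- Schwartz–Bruhat functions on a local field: locally constant functions with compact support
if the field is nonarchimedean, Schwartz functions (for the structure of a real normed space)
if the field is archimedean. -/
def IsSchwartzBruhat (f : K → ℂ) : Prop :=
  (IsUltrametricDist K ∧ IsLocallyConstant f ∧ HasCompactSupport f) ∨
    ∃ _ : NormedAlgebra ℝ K, ∃ g : SchwartzMap K ℂ, ⇑g = f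

/-- Test functions on the punctured line: Schwartz–Bruhat functions which vanish identically in
a neighbourhood of the origin. -/
def IsPuncturedTest (f : K → ℂ) : Prop :=
  IsSchwartzBruhat f ∧ ∀ᶠ y in 𝓝 (0 : K), f y = 0

section Modulus

variable [LocallyCompactSpace K]

open Classical in
/-- The normalized absolute value `|y|`, that is the module of the homothety `t ↦ y * t`
for the additive Haar measure (the usual `|y|` on `ℝ`, but `y * conj y` on `ℂ`;
`1 / q` at a uniformizer of a nonarchimedean field). -/
def modulus (y : K) : ℝ :=
  if h : y = 0 then 0 else (distribHaarChar K (Units.mk0 y h) : ℝ)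

open Classical in
/-- A unitary character of the multiplicative group, as a function on the field
(extended by `0` at the origin). -/
def charFun (χ : Kˣ →ₜ* Circle) (y : K) : ℂ :=
  if h : y = 0 then 0 else (χ (Units.mk0 y h) : ℂ)

/-- The function `χ⁻¹(y) |y|^(-s)`. -/
def homogeneous (χ : Kˣ →ₜ* Circle) (s : ℂ) (y : K) : ℂ :=
  (charFun χ y)⁻¹ * (modulus y : ℂ) ^ (-s)

end Modulus

variable [MeasurableSpace K]

/-- `μ` is self-dual for the additive character `e`: Fourier inversion holds,
the Fourier transform being `x ↦ ∫ f(y) e(-x y) dμ(y)`. -/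
def IsSelfDual (e : AddChar K Circle) (μ : Measure K) : Prop :=
  ∀ f : K → ℂ, IsSchwartzBruhat f →
    ∀ y, Fourier.fourierIntegral e μ (Fourier.fourierIntegral e μ f) y = f (-y)

variable [LocallyCompactSpace K]

/-- The functional equation
`∫ f̃(x) χ(x) |x|^(s-1) dx = γ ∫ f(y) χ⁻¹(y) |y|^(-s) dy`
for all Schwartz–Bruhat functions `f`, all integrals being absolutely convergent. -/
def IsTateGamma (e : AddChar K Circle) (μ : Measure K) (χ : Kˣ →ₜ* Circle) (s γ : ℂ) : Prop :=
  ∀ f : K → ℂ, IsSchwartzBruhat f →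
    Integrable (fun x => Fourier.fourierIntegral e μ f x *
      (charFun χ x * (modulus x : ℂ) ^ (s - 1))) μ ∧
    Integrable (fun y => f y * homogeneous χ s y) μ ∧
    ∫ x, Fourier.fourierIntegral e μ f x * (charFun χ x * (modulus x : ℂ) ^ (s - 1)) ∂μ =
      γ * ∫ y, f y * homogeneous χ s y ∂μ

open Classical in
/-- The Tate–Gel'fand–Graev Gamma function `Γ(χ, s)` in the critical strip: the constant in the
functional equation. -/
def tateGamma (e : AddChar K Circle) (μ : Measure K) (χ : Kˣ →ₜ* Circle) (s : ℂ) : ℂ :=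
  if h : ∃ γ, IsTateGamma e μ χ s γ then h.choose else 0

/-- `A`: multiplication by `log |y|`. -/
def opA (f : K → ℂ) (y : K) : ℂ := (Real.log (modulus y) : ℂ) * f y

/-- `B = F⁻¹ A F`, that is multiplication by `log |x|` in the Fourier dual variable `x`;
the inverse transform `y ↦ ∫ g(x) e(x y) dμ(x)` is the Fourier transform at `-y`. -/
def opB (e : AddChar K Circle) (μ : Measure K) (f : K → ℂ) (y : K) : ℂ :=
  Fourier.fourierIntegral e μ (opA (Fourier.fourierIntegral e μ f)) (-y)

/-- The conductor operator `H = A + B`. -/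
def conductor (e : AddChar K Circle) (μ : Measure K) (f : K → ℂ) (y : K) : ℂ :=
  opA f y + opB e μ f y

/-- The higher commutators, `K_1 = [A, H]` and `K_(N+1) = [A, K_N]` (with `K_0 = H`), as operators
on test functions on the punctured line (a space which is stable under `A`). -/
def commutator (e : AddChar K Circle) (μ : Measure K) : ℕ → (K → ℂ) → (K → ℂ)
  | 0, f => conductor e μ f
  | N + 1, f => fun y => opA (commutator e μ N f) y - commutator e μ N (opA f) y

/-- The pairing of a function with a test function: the distribution `T(y) dy`. -/
def pairing (μ : Measure K) (T α : K → ℂ) : ℂ := ∫ y, T y * α y ∂μ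

/-- The distribution `K_N(T)` on the punctured line, by transposition: since
`∫ K_N(α₁) α₂ = (-1)^N ∫ α₁ K_N(α₂)` for test functions, `⟨K_N(T), α⟩ = (-1)^N ⟨T, K_N(α)⟩`. -/
def commutatorDist (e : AddChar K Circle) (μ : Measure K) (N : ℕ) (T α : K → ℂ) : ℂ :=
  (-1) ^ N * pairing μ T (commutator e μ N α)

end LocalCommutator

end

/-! The engine is a kernel formula. Away from the origin the Fourier transform of `log |x|` is `c /
|y|` for some constant `c` (`exists_integral_log_fourier`), so `B` has kernel `c / |z - y|` off the
diagonal. Each commutator with `A` multiplies the kernel by `log |y| - log |z|`. This factor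
vanishes on the diagonal, so for `N ≥ 1` the operator `K_N` has the honest kernel `c (log |y| - log
|z|)^N / |z - y|` (`commutator_eq_kernel`).

Exchanging `y` and `z` multiplies this kernel by `(-1)^N`, which with Fubini gives the transposition
rule. It is also homogeneous of degree `-1`: putting `y = z u`, its pairing with `χ⁻¹(y) |y|^(-s)`
produces the factor `c M_N(s)`, where `M_N(s) = ∫ log^N |u| |1 - u|⁻¹ χ⁻¹(u) |u|^(-s) du` converges
absolutely for `0 < Re s < 1` (`mellinStrip_mulKernel`, `pairing_homogeneous_commutator`). For the
same reason `|y|^(-1/2)` is an eigenfunction of the absolute value of the kernel, and Schur's test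
gives boundedness on `L²`.

It remains to identify `c M_N` with a derivative of `log Γ`. Write `M(f, s)` for the Mellin
transform with `χ` and `f̃` for the Fourier transform, whose Mellin transform is taken with `χ⁻¹`.
Fubini and Parseval give `M(g, s) M(f̃, 1 - s) = M(f, s) M(g̃, 1 - s)` (`functional_equation_symm`),
hence Tate's `Γ` as a quotient. Differentiating `M(f̃, 1 - s) = Γ(s) M(f, s)` gives `M(H f) = (Γ'/Γ)
M(f)`. Differentiating once more, and using the same identity for `A f`, gives `(Γ'/Γ)' = -c M_1`
(`hasDerivAt_logDeriv_tateGamma`). All larger `N` follow from `M_N' = -M_{N+1}`. -/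

set_option linter.unusedSectionVars false

noncomputable section

namespace LocalCommutator

open Filter Set
open scoped ENNReal NNReal Pointwise

/-! ### The modulus: Haar scaling and comparison with the norm. -/

section Modulus

variable {K : Type*} [NontriviallyNormedField K] [ProperSpace K]

@[simp]
lemma modulus_zero : modulus (0 : K) = 0 := by simp [modulus]

lemma modulus_of_ne_zero {y : K} (h : y ≠ 0) :
    modulus y = (distribHaarChar K (Units.mk0 y h) : ℝ) := by simp [modulus, h]

lemma modulus_pos {y : K} (h : y ≠ 0) : 0 < modulus y := by
  rw [modulus_of_ne_zero h]
  exact_mod_cast distribHaarChar_pos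

lemma modulus_nonneg (y : K) : 0 ≤ modulus y := by
  rcases eq_or_ne y 0 with rfl | h
  · simp
  · exact (modulus_pos h).le

@[simp]
lemma modulus_one : modulus (1 : K) = 1 := by
  rw [modulus_of_ne_zero one_ne_zero]
  simp

lemma modulus_mul (x y : K) : modulus (x * y) = modulus x * modulus y := by
  rcases eq_or_ne x 0 with rfl | hx
  · simp
  rcases eq_or_ne y 0 with rfl | hy
  · simp
  rw [modulus_of_ne_zero hx, modulus_of_ne_zero hy, modulus_of_ne_zero (mul_ne_zero hx hy),
    Units.mk0_mul _ _ (mul_ne_zero hx hy), map_mul]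
  rfl

lemma modulus_inv (x : K) : modulus x⁻¹ = (modulus x)⁻¹ := by
  rcases eq_or_ne x 0 with rfl | hx
  · simp
  · refine eq_inv_of_mul_eq_one_left ?_
    rw [← modulus_mul, inv_mul_cancel₀ hx, modulus_one]

lemma modulus_pow (x : K) (n : ℕ) : modulus (x ^ n) = modulus x ^ n := by
  induction n with
  | zero => simp
  | succ n ih => rw [pow_succ, modulus_mul, ih, pow_succ]

section Haar

variable [MeasurableSpace K] [BorelSpace K] (μ : Measure K) [μ.IsAddHaarMeasure]

lemma measure_smul_set {a : K} (ha : a ≠ 0) (s : Set K) :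
    μ (a • s) = ENNReal.ofReal (modulus a) * μ s := by
  have h := distribHaarChar_mul μ (Units.mk0 a ha) s
  rw [modulus_of_ne_zero ha, ENNReal.ofReal_coe_nnreal, h]
  rfl

lemma map_mul_left_eq {a : K} (ha : a ≠ 0) :
    Measure.map (fun y => a * y) μ = ENNReal.ofReal (modulus a)⁻¹ • μ := by
  ext s hs
  rw [Measure.map_apply (measurable_const_mul a) hs, Measure.smul_apply, ← modulus_inv,
    smul_eq_mul, ← measure_smul_set μ (inv_ne_zero ha)]
  congr 1
  exact (Set.preimage_smul₀ ha s)

lemma measurableEmbedding_mul_left {a : K} (ha : a ≠ 0) :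
    MeasurableEmbedding (fun y : K => a * y) :=
  (Homeomorph.mulLeft₀ a ha).measurableEmbedding

lemma integral_comp_mul {E : Type*} [NormedAddCommGroup E] [NormedSpace ℝ E] (f : K → E)
    {a : K} (ha : a ≠ 0) : ∫ y, f (a * y) ∂μ = (modulus a)⁻¹ • ∫ y, f y ∂μ := by
  rw [← (measurableEmbedding_mul_left ha).integral_map, map_mul_left_eq μ ha,
    integral_smul_measure, ENNReal.toReal_ofReal (inv_nonneg.2 (modulus_nonneg a))]

lemma integrable_comp_mul {E : Type*} [NormedAddCommGroup E] {f : K → E}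
    {a : K} (ha : a ≠ 0) : Integrable (fun y => f (a * y)) μ ↔ Integrable f μ := by
  have h := (measurableEmbedding_mul_left ha).integrable_map_iff (μ := μ) (g := f)
  rw [map_mul_left_eq μ ha] at h
  have h2 := inv_pos.2 (modulus_pos ha)
  rw [integrable_smul_measure (by simpa using h2) ENNReal.ofReal_ne_top] at h
  exact h.symm

lemma lintegral_comp_mul (f : K → ℝ≥0∞)
    {a : K} (ha : a ≠ 0) :
    ∫⁻ y, f (a * y) ∂μ = ENNReal.ofReal (modulus a)⁻¹ * ∫⁻ y, f y ∂μ := by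
  rw [← (measurableEmbedding_mul_left ha).lintegral_map, map_mul_left_eq μ ha,
    lintegral_smul_measure, smul_eq_mul]

end Haar

lemma modulus_le_modulus {x y : K} (h : ‖x‖ ≤ ‖y‖) : modulus x ≤ modulus y := by
  rcases eq_or_ne x 0 with rfl | hx
  · simpa using modulus_nonneg y
  have hy : y ≠ 0 := norm_pos_iff.1 ((norm_pos_iff.2 hx).trans_le h)
  borelize K
  let μ : Measure K := Measure.addHaar
  have key : x • Metric.closedBall (0 : K) 1 ⊆ y • Metric.closedBall (0 : K) 1 := by
    rw [smul_closedBall x _ zero_le_one, smul_closedBall y _ zero_le_one]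
    simpa using Metric.closedBall_subset_closedBall h
  have h2 := measure_mono (μ := μ) key
  rw [measure_smul_set μ hx, measure_smul_set μ hy] at h2
  have h3 : μ (Metric.closedBall (0 : K) 1) ≠ 0 :=
    (Metric.measure_closedBall_pos μ 0 one_pos).ne'
  have h4 : μ (Metric.closedBall (0 : K) 1) ≠ ∞ := (isCompact_closedBall 0 1).measure_ne_top
  rw [ENNReal.mul_le_mul_iff_left h3 h4] at h2
  exact (ENNReal.ofReal_le_ofReal_iff (modulus_nonneg y)).1 h2

/-- The balls of radius `‖x‖ ^ n` shrink to a point of measure zero, whereas a modulus at least `1`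
would keep their measures above that of the unit ball. -/
lemma modulus_lt_one {x : K} (h : ‖x‖ < 1) : modulus x < 1 := by
  rcases eq_or_ne x 0 with rfl | hx
  · simp
  borelize K
  let μ : Measure K := Measure.addHaar
  by_contra! hc
  have hlim : Tendsto (fun n : ℕ => μ (Metric.closedBall (0 : K) (‖x‖ ^ n))) atTop (𝓝 0) := by
    have hinter : ⋂ n : ℕ, Metric.closedBall (0 : K) (‖x‖ ^ n) = {0} := by
      ext y
      simp only [mem_iInter, Metric.mem_closedBall, dist_zero_right, mem_singleton_iff]
      refine ⟨fun hy => ?_, fun hy => by simp [hy]⟩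
      exact norm_le_zero_iff.1 (ge_of_tendsto' (tendsto_pow_atTop_nhds_zero_of_lt_one
        (norm_nonneg x) h) hy)
    have := tendsto_measure_iInter_atTop (μ := μ)
      (s := fun n : ℕ => Metric.closedBall (0 : K) (‖x‖ ^ n))
      (fun n => measurableSet_closedBall.nullMeasurableSet)
      (fun m n hmn => Metric.closedBall_subset_closedBall
        (pow_le_pow_of_le_one (norm_nonneg x) h.le hmn))
      ⟨0, (isCompact_closedBall 0 _).measure_ne_top⟩
    rw [hinter] at this
    simpa [Function.comp_def] using this
  have hb : ∀ n : ℕ, μ (Metric.closedBall (0 : K) 1) ≤ μ (Metric.closedBall (0 : K) (‖x‖ ^ n)) := by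
    intro n
    have e1 : x ^ n • Metric.closedBall (0 : K) 1 = Metric.closedBall (0 : K) (‖x‖ ^ n) := by
      rw [smul_closedBall _ _ zero_le_one]
      simp
    rw [← e1, measure_smul_set μ (pow_ne_zero n hx), modulus_pow]
    exact le_mul_of_one_le_left' (by simpa using one_le_pow₀ hc)
  exact (Metric.measure_closedBall_pos μ (0 : K) one_pos).not_ge (ge_of_tendsto' hlim hb)

-- Norm and modulus are multiplicative and ordered alike, so each is determined by comparing powers
-- of `y` with powers of one fixed `p`. The exponent `d` later converts norm estimates into modulus
-- estimates.
variable (K) in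
lemma exists_modulus_eq_norm_rpow : ∃ d : ℝ, 0 < d ∧ ∀ y : K, modulus y = ‖y‖ ^ d := by
  obtain ⟨p, hp0, hp1⟩ := NormedField.exists_norm_lt_one K
  have hp : p ≠ 0 := norm_pos_iff.1 hp0
  have hl : Real.log ‖p‖ < 0 := Real.log_neg hp0 hp1
  have hm : Real.log (modulus p) < 0 := Real.log_neg (modulus_pos hp) (modulus_lt_one hp1)
  refine ⟨Real.log (modulus p) / Real.log ‖p‖, div_pos_of_neg_of_neg hm hl, fun y => ?_⟩
  rcases eq_or_ne y 0 with rfl | hy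
  · rw [modulus_zero, norm_zero, Real.zero_rpow (div_pos_of_neg_of_neg hm hl).ne']
  have hy' := norm_pos_iff.2 hy
  have mono : ∀ (a b : K), a ≠ 0 → b ≠ 0 → Real.log ‖a‖ ≤ Real.log ‖b‖ →
      Real.log (modulus a) ≤ Real.log (modulus b) := fun a b ha hb h =>
    Real.log_le_log (modulus_pos ha) (modulus_le_modulus
      ((Real.log_le_log_iff (norm_pos_iff.2 ha) (norm_pos_iff.2 hb)).1 h))
  have zp : ∀ (a : K) (n : ℤ), modulus (a ^ n) = modulus a ^ n := by
    intro a n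
    cases n with
    | ofNat n => simpa using modulus_pow a n
    | negSucc n => simp [zpow_negSucc, modulus_inv, modulus_pow]
  -- If the two ratios differed, a rational `num / den` would lie strictly between them, and `p ^
  -- num`, `y ^ den` would be ordered oppositely by norm and by modulus.
  have key : Real.log (modulus y) / Real.log (modulus p) = Real.log ‖y‖ / Real.log ‖p‖ := by
    refine le_antisymm ?_ ?_
    · by_contra! hc
      obtain ⟨r, h1, h2⟩ := exists_rat_btwn hc
      rw [div_lt_iff_of_neg hl] at h1
      rw [lt_div_iff_of_neg hm] at h2
      have hd : (0 : ℝ) < r.den := by exact_mod_cast r.den_pos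
      have hr : (r : ℝ) = r.num / r.den := Rat.cast_def r
      rw [hr, div_mul_eq_mul_div] at h1 h2
      rw [div_lt_iff₀ hd] at h1
      rw [lt_div_iff₀ hd] at h2
      have := mono (p ^ r.num) (y ^ r.den) (zpow_ne_zero _ hp) (pow_ne_zero _ hy) (by
        rw [norm_zpow, norm_pow, Real.log_zpow, Real.log_pow]; linarith)
      rw [zp, modulus_pow, Real.log_zpow, Real.log_pow] at this
      linarith
    · by_contra! hc
      obtain ⟨r, h1, h2⟩ := exists_rat_btwn hc
      rw [div_lt_iff_of_neg hm] at h1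
      rw [lt_div_iff_of_neg hl] at h2
      have hd : (0 : ℝ) < r.den := by exact_mod_cast r.den_pos
      have hr : (r : ℝ) = r.num / r.den := Rat.cast_def r
      rw [hr, div_mul_eq_mul_div] at h1 h2
      rw [div_lt_iff₀ hd] at h1
      rw [lt_div_iff₀ hd] at h2
      have := mono (y ^ r.den) (p ^ r.num) (pow_ne_zero _ hy) (zpow_ne_zero _ hp) (by
        rw [norm_zpow, norm_pow, Real.log_zpow, Real.log_pow]; linarith)
      rw [zp, modulus_pow, Real.log_zpow, Real.log_pow] at this
      linarith
  rw [Real.rpow_def_of_pos hy', ← Real.exp_log (modulus_pos hy)]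
  congr 1
  rw [div_eq_div_iff hm.ne hl.ne] at key
  rw [mul_div_assoc', eq_div_iff hl.ne, key]

lemma continuous_modulus : Continuous (modulus : K → ℝ) := by
  obtain ⟨d, hd, h⟩ := exists_modulus_eq_norm_rpow K
  rw [funext h]
  exact continuous_norm.rpow_const fun _ => Or.inr hd.le

lemma modulus_neg (y : K) : modulus (-y) = modulus y := by
  obtain ⟨d, -, h⟩ := exists_modulus_eq_norm_rpow K
  rw [h, h, norm_neg]

end Modulus

end LocalCommutator

end

noncomputable section

namespace LocalCommutator

open Filter Set
open scoped ENNReal NNReal Pointwise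

/-! ### Integrability of powers of the modulus near zero and near infinity. -/

section Integrability

variable {K : Type*} [NontriviallyNormedField K] [ProperSpace K]
variable [MeasurableSpace K] [BorelSpace K] {μ : Measure K} [μ.IsAddHaarMeasure]

lemma isBounded_modulus_le (M : ℝ) : Bornology.IsBounded {y : K | modulus y ≤ M} := by
  obtain ⟨d, hd, h⟩ := exists_modulus_eq_norm_rpow K
  refine (Metric.isBounded_closedBall (x := (0 : K)) (r := |M| ^ d⁻¹)).subset fun y hy => ?_
  rw [mem_closedBall_zero_iff]
  have h1 : ‖y‖ ^ d ≤ |M| := (h y) ▸ (hy.trans (le_abs_self M))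
  calc ‖y‖ = (‖y‖ ^ d) ^ d⁻¹ := (Real.rpow_rpow_inv (norm_nonneg y) hd.ne').symm
    _ ≤ _ := Real.rpow_le_rpow (by positivity) h1 (by positivity)

lemma ae_ne_zero : ∀ᵐ y : K ∂μ, y ≠ 0 := by
  have : ({(0 : K)}ᶜ : Set K) ∈ ae μ := by
    rw [mem_ae_iff, compl_compl]; exact measure_singleton 0
  exact this

/-- Dilating `S` by `r ^ n` multiplies the integral of `|y|^(-c)` by the `n`-th power of `modulus r
^ (1 - c)`, so the shells are dominated by a geometric series. A small `r` exhausts a neighbourhood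
of zero, a large one a neighbourhood of infinity. -/
lemma lintegral_shells_lt_top {r : K} (hr : r ≠ 0) {S : Set K} (hS : MeasurableSet S) {m M c : ℝ}
    (hm : 0 < m) (hSm : ∀ y ∈ S, m ≤ modulus y ∧ modulus y ≤ M)
    (h : modulus r ^ (1 - c) < 1) :
    ∫⁻ y in ⋃ n : ℕ, {y | (r ^ n)⁻¹ * y ∈ S}, ENNReal.ofReal (modulus y ^ (-c)) ∂μ < ∞ := by
  have hrp := modulus_pos hr
  have hgm : Measurable fun y : K => ENNReal.ofReal (modulus y ^ (-c)) :=
    (continuous_modulus.measurable.pow_const _).ennreal_ofReal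
  have hI : ∫⁻ y in S, ENNReal.ofReal (modulus y ^ (-c)) ∂μ < ∞ := by
    have hfin : μ S < ∞ :=
      ((isBounded_modulus_le M).subset fun y hy => (hSm y hy).2).measure_lt_top
    refine setLIntegral_lt_top_of_le_nnreal hfin.ne
      ⟨Real.toNNReal (max (m ^ (-c)) (M ^ (-c))), fun y hy => ENNReal.ofReal_le_ofReal ?_⟩
    obtain ⟨h1, h2⟩ := hSm y hy
    rcases le_total (-c) 0 with hc | hc
    · exact (Real.rpow_le_rpow_of_nonpos hm h1 hc).trans (le_max_left _ _)
    · exact (Real.rpow_le_rpow (hm.le.trans h1) h2 hc).trans (le_max_right _ _)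
  have hn : ∀ n : ℕ, ∫⁻ y in {y | (r ^ n)⁻¹ * y ∈ S}, ENNReal.ofReal (modulus y ^ (-c)) ∂μ =
      ENNReal.ofReal (modulus r ^ (1 - c)) ^ n *
        ∫⁻ y in S, ENNReal.ofReal (modulus y ^ (-c)) ∂μ := by
    intro n
    have hrn : (r ^ n)⁻¹ ≠ 0 := inv_ne_zero (pow_ne_zero n hr)
    have hSn : MeasurableSet {y | (r ^ n)⁻¹ * y ∈ S} := measurable_const_mul _ hS
    rw [← lintegral_indicator hSn, ← lintegral_indicator hS]
    have e1 : ({y | (r ^ n)⁻¹ * y ∈ S}.indicator fun y : K => ENNReal.ofReal (modulus y ^ (-c))) =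
        fun y => ENNReal.ofReal ((modulus r ^ n) ^ (-c)) *
          S.indicator (fun y : K => ENNReal.ofReal (modulus y ^ (-c))) ((r ^ n)⁻¹ * y) := by
      ext y
      by_cases hy : (r ^ n)⁻¹ * y ∈ S
      · rw [indicator_of_mem hy, indicator_of_mem (show y ∈ {y | (r ^ n)⁻¹ * y ∈ S} from hy),
          ← ENNReal.ofReal_mul (by positivity), ← Real.mul_rpow (by positivity)
          (modulus_nonneg _), ← modulus_pow, ← modulus_mul, mul_inv_cancel_left₀ (pow_ne_zero n hr)]
      · rw [indicator_of_notMem hy,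
          indicator_of_notMem (show y ∉ {y | (r ^ n)⁻¹ * y ∈ S} from hy), mul_zero]
    have hmeas : Measurable fun y : K =>
        S.indicator (fun y : K => ENNReal.ofReal (modulus y ^ (-c))) ((r ^ n)⁻¹ * y) :=
      (hgm.indicator hS).comp (measurable_const_mul _)
    simp only [e1]
    rw [lintegral_const_mul _ hmeas,
      lintegral_comp_mul _ _ hrn, ← mul_assoc, ← ENNReal.ofReal_mul (by positivity),
      ← ENNReal.ofReal_pow (by positivity), modulus_inv, inv_inv, modulus_pow,
      ← Real.rpow_mul_natCast hrp.le, mul_comm (1 - c), Real.rpow_natCast_mul hrp.le,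
      sub_eq_neg_add, Real.rpow_add (by positivity), Real.rpow_one]
  refine (lintegral_iUnion_le _ _).trans_lt ?_
  simp_rw [hn]
  rw [ENNReal.tsum_mul_right, ENNReal.tsum_geometric]
  refine ENNReal.mul_lt_top (ENNReal.inv_lt_top.2 ?_) hI
  rw [tsub_pos_iff_lt]
  simpa using h

lemma lintegral_modulus_small_lt_top {a : ℝ} (ha : a < 1) :
    ∫⁻ y in {y : K | modulus y ≤ 1}, ENNReal.ofReal (modulus y ^ (-a)) ∂μ < ∞ := by
  obtain ⟨p, hp0, hp1⟩ := NormedField.exists_norm_lt_one K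
  have hp : p ≠ 0 := norm_pos_iff.1 hp0
  have hq := modulus_pos hp
  have hq1 := modulus_lt_one hp1
  have h := lintegral_shells_lt_top (μ := μ) hp (S := {y : K | modulus p < modulus y ∧ modulus y ≤ 1})
    ((measurableSet_lt measurable_const continuous_modulus.measurable).inter
      (measurableSet_le continuous_modulus.measurable measurable_const)) hq
    (fun y hy => ⟨hy.1.le, hy.2⟩) (c := a) (Real.rpow_lt_one hq.le hq1 (by linarith))
  refine lt_of_le_of_lt (lintegral_mono_set' ?_) h
  filter_upwards [ae_ne_zero] with y hy hy1
  obtain ⟨n, h1, h2⟩ := exists_nat_pow_near_of_lt_one (modulus_pos hy) hy1 hq hq1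
  refine mem_iUnion.2 ⟨n, ?_⟩
  have hqn : 0 < modulus p ^ n := by positivity
  simp only [mem_ofPred_eq, modulus_mul, modulus_inv, modulus_pow]
  rw [inv_mul_eq_div]
  exact ⟨by rwa [lt_div_iff₀ hqn, ← pow_succ'], by rwa [div_le_one hqn]⟩

lemma lintegral_modulus_large_lt_top {b : ℝ} (hb : 1 < b) :
    ∫⁻ y in {y : K | 1 ≤ modulus y}, ENNReal.ofReal (modulus y ^ (-b)) ∂μ < ∞ := by
  obtain ⟨p, hp0, hp1⟩ := NormedField.exists_norm_lt_one K
  have hp : p ≠ 0 := norm_pos_iff.1 hp0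
  have hq : 0 < modulus p⁻¹ := modulus_pos (inv_ne_zero hp)
  have hq1 : 1 < modulus p⁻¹ := by
    rw [modulus_inv]; exact (one_lt_inv₀ (modulus_pos hp)).2 (modulus_lt_one hp1)
  have h := lintegral_shells_lt_top (μ := μ) (inv_ne_zero hp)
    (S := {y : K | 1 ≤ modulus y ∧ modulus y ≤ modulus p⁻¹})
    ((measurableSet_le measurable_const continuous_modulus.measurable).inter
      (measurableSet_le continuous_modulus.measurable measurable_const)) one_pos
    (fun y hy => hy) (c := b) (Real.rpow_lt_one_of_one_lt_of_neg hq1 (by linarith))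
  refine lt_of_le_of_lt (lintegral_mono_set ?_) h
  intro y hy
  obtain ⟨n, h1, h2⟩ := exists_nat_pow_near hy hq1
  refine mem_iUnion.2 ⟨n, ?_⟩
  have hqn : 0 < modulus p⁻¹ ^ n := by positivity
  rw [mem_ofPred_eq, mem_ofPred_eq, modulus_mul, modulus_inv (p⁻¹ ^ n), modulus_pow, inv_mul_eq_div]
  exact ⟨by rwa [one_le_div hqn], by rw [div_le_iff₀ hqn, ← pow_succ']; exact h2.le⟩

/-- A function dominated by `|y|^(-a)` and by `|y|^(-b)` with `a < 1 < b` is integrable. -/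
lemma integrable_of_modulus_bounds {E : Type*} [NormedAddCommGroup E] {f : K → E}
    (hf : AEStronglyMeasurable f μ) {a b C : ℝ} (ha : a < 1) (hb : 1 < b)
    (h : ∀ y ≠ 0, ‖f y‖ ≤ C * modulus y ^ (-a)) (h' : ∀ y ≠ 0, ‖f y‖ ≤ C * modulus y ^ (-b)) :
    Integrable f μ := by
  have hC : ∀ y : K, y ≠ 0 → 0 ≤ C := fun y hy => by
    have h1 := (norm_nonneg _).trans (h y hy)
    exact nonneg_of_mul_nonneg_left h1 (Real.rpow_pos_of_pos (modulus_pos hy) _)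
  have hC0 : 0 ≤ C := hC 1 one_ne_zero
  have hm : ∀ c : ℝ, Measurable fun y : K => ENNReal.ofReal (modulus y ^ (-c)) := fun c =>
    (continuous_modulus.measurable.pow_const _).ennreal_ofReal
  refine ⟨hf, ?_⟩
  have hU : {y : K | modulus y ≤ 1} ∪ {y : K | 1 ≤ modulus y} = univ := by
    ext y; simpa using le_total _ _
  rw [hasFiniteIntegral_iff_enorm, ← setLIntegral_univ, ← hU]
  refine (lintegral_union_le _ _ _).trans_lt (ENNReal.add_lt_top.2 ⟨?_, ?_⟩)
  · refine lt_of_le_of_lt (b := ∫⁻ y in {y : K | modulus y ≤ 1},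
      ENNReal.ofReal C * ENNReal.ofReal (modulus y ^ (-a)) ∂μ) (lintegral_mono_ae ?_) ?_
    · filter_upwards [ae_restrict_of_ae ae_ne_zero] with y hy
      rw [← ENNReal.ofReal_mul hC0, ← ofReal_norm]
      exact ENNReal.ofReal_le_ofReal (h y hy)
    · rw [lintegral_const_mul _ (hm a)]
      exact ENNReal.mul_lt_top ENNReal.ofReal_lt_top (lintegral_modulus_small_lt_top ha)
  · refine lt_of_le_of_lt (b := ∫⁻ y in {y : K | 1 ≤ modulus y},
      ENNReal.ofReal C * ENNReal.ofReal (modulus y ^ (-b)) ∂μ) (lintegral_mono_ae ?_) ?_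
    · filter_upwards [ae_restrict_of_ae ae_ne_zero] with y hy
      rw [← ENNReal.ofReal_mul hC0, ← ofReal_norm]
      exact ENNReal.ofReal_le_ofReal (h' y hy)
    · rw [lintegral_const_mul _ (hm b)]
      exact ENNReal.mul_lt_top ENNReal.ofReal_lt_top (lintegral_modulus_large_lt_top hb)

end Integrability

/-! ### Quasi-characters `χ⁻¹(y) |y|^(-s)`. -/

section Characters

variable {K : Type*} [NontriviallyNormedField K] [ProperSpace K]

lemma charFun_of_ne_zero (χ : Kˣ →ₜ* Circle) {y : K} (h : y ≠ 0) :
    charFun χ y = (χ (Units.mk0 y h) : ℂ) := by simp [charFun, h]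

lemma norm_charFun (χ : Kˣ →ₜ* Circle) {y : K} (h : y ≠ 0) : ‖charFun χ y‖ = 1 := by
  rw [charFun_of_ne_zero χ h, Circle.norm_coe]

lemma charFun_ne_zero (χ : Kˣ →ₜ* Circle) {y : K} (h : y ≠ 0) : charFun χ y ≠ 0 := by
  rw [← norm_ne_zero_iff, norm_charFun χ h]
  exact one_ne_zero

lemma charFun_mul (χ : Kˣ →ₜ* Circle) (x y : K) :
    charFun χ (x * y) = charFun χ x * charFun χ y := by
  rcases eq_or_ne x 0 with rfl | hx
  · simp [charFun]
  rcases eq_or_ne y 0 with rfl | hy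
  · simp [charFun]
  rw [charFun_of_ne_zero χ hx, charFun_of_ne_zero χ hy, charFun_of_ne_zero χ (mul_ne_zero hx hy),
    Units.mk0_mul _ _ (mul_ne_zero hx hy), map_mul, Circle.coe_mul]

lemma charFun_inv_char (χ : Kˣ →ₜ* Circle) (y : K) : charFun χ⁻¹ y = (charFun χ y)⁻¹ := by
  rcases eq_or_ne y 0 with rfl | hy
  · simp [charFun]
  rw [charFun_of_ne_zero _ hy, charFun_of_ne_zero _ hy, ← Circle.coe_inv]
  rfl

lemma continuousOn_charFun (χ : Kˣ →ₜ* Circle) : ContinuousOn (charFun χ) {(0 : K)}ᶜ := by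
  rw [continuousOn_iff_continuous_domRestrict]
  have h1 : Continuous fun y : ({(0 : K)}ᶜ : Set K) => Units.mk0 y.1 (fun h => y.2 h) :=
    Units.isEmbedding_val₀.continuous_iff.2 continuous_subtype_val
  have : ({(0 : K)}ᶜ : Set K).domRestrict (charFun χ) =
      fun y => ((χ (Units.mk0 y.1 (fun h => y.2 h)) : Circle) : ℂ) := by
    ext y
    rw [domRestrict_apply, charFun_of_ne_zero χ (fun h => y.2 h)]
  rw [this]
  have h2 : Continuous χ := χ.continuous_toFun
  exact continuous_subtype_val.comp (h2.comp h1)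

lemma continuousOn_homogeneous (χ : Kˣ →ₜ* Circle) (s : ℂ) :
    ContinuousOn (homogeneous χ s) {(0 : K)}ᶜ := by
  refine ((continuousOn_charFun χ).inv₀ fun y hy => charFun_ne_zero χ hy).mul ?_
  refine ContinuousOn.cpow_const
    (Complex.continuous_ofReal.comp continuous_modulus).continuousOn fun y hy => ?_
  exact Complex.ofReal_mem_slitPlane.2 (modulus_pos hy)

lemma norm_homogeneous (χ : Kˣ →ₜ* Circle) (s : ℂ) {y : K} (hy : y ≠ 0) :
    ‖homogeneous χ s y‖ = modulus y ^ (-s.re) := by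
  rw [homogeneous, norm_mul, norm_inv, norm_charFun χ hy, inv_one, one_mul,
    Complex.norm_cpow_eq_rpow_re_of_pos (modulus_pos hy), Complex.neg_re]

lemma homogeneous_mul (χ : Kˣ →ₜ* Circle) (s : ℂ) (x y : K) :
    homogeneous χ s (x * y) = homogeneous χ s x * homogeneous χ s y := by
  rw [homogeneous, homogeneous, homogeneous, charFun_mul, modulus_mul, Complex.ofReal_mul,
    Complex.mul_cpow_ofReal_nonneg (modulus_nonneg x) (modulus_nonneg y)]
  ring

lemma homogeneous_inv_char (χ : Kˣ →ₜ* Circle) (s : ℂ) (x : K) :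
    homogeneous χ⁻¹ (1 - s) x = charFun χ x * (modulus x : ℂ) ^ (s - 1) := by
  rw [homogeneous, charFun_inv_char, inv_inv, neg_sub]

/-- The parameters `(χ, s)` and `(χ⁻¹, 1 - s)` on the two sides of the functional equation are dual:
the product is the density of the multiplicative Haar measure. -/
lemma homogeneous_mul_homogeneous_inv_char (χ : Kˣ →ₜ* Circle) (s : ℂ) {x : K} (hx : x ≠ 0) :
    homogeneous χ s x * homogeneous χ⁻¹ (1 - s) x = ((modulus x)⁻¹ : ℝ) := by
  have h := modulus_pos hx
  have h' : (modulus x : ℂ) ≠ 0 := by exact_mod_cast h.ne'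
  rw [homogeneous_inv_char, homogeneous]
  calc _ = ((charFun χ x)⁻¹ * charFun χ x) * ((modulus x : ℂ) ^ (-s) * (modulus x : ℂ) ^ (s - 1)) := by
        ring
    _ = _ := by
      rw [inv_mul_cancel₀ (charFun_ne_zero χ hx), one_mul, ← Complex.cpow_add _ _ h',
        show -s + (s - 1) = -1 by ring, Complex.cpow_neg_one, Complex.ofReal_inv]

variable [MeasurableSpace K] [BorelSpace K]

lemma measurable_homogeneous (χ : Kˣ →ₜ* Circle) (s : ℂ) :
    Measurable (homogeneous χ s : K → ℂ) :=
  measurable_of_continuousOn_compl_singleton 0 (continuousOn_homogeneous χ s)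

end Characters

/-! ### Mellin transforms in a strip and their derivatives. -/

section Strip

lemma abs_log_le_rpow {m δ : ℝ} (hm : 0 < m) (hδ : 0 < δ) :
    |Real.log m| ≤ δ⁻¹ * (m ^ δ + m ^ (-δ)) := by
  have h1 : Real.log m ≤ m ^ δ / δ := Real.log_le_rpow_div hm.le hδ
  have h2 : -Real.log m ≤ m ^ (-δ) / δ := by
    rw [← Real.log_inv, Real.rpow_neg_eq_inv_rpow]
    exact Real.log_le_rpow_div (inv_nonneg.2 hm.le) hδ
  have p1 : 0 < m ^ δ / δ := by positivity
  have p2 : 0 < m ^ (-δ) / δ := by positivity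
  have : δ⁻¹ * (m ^ δ + m ^ (-δ)) = m ^ δ / δ + m ^ (-δ) / δ := by field_simp
  rw [this, abs_le]
  constructor <;> linarith

lemma rpow_le_add_rpow {m a b c : ℝ} (hm : 0 < m) (ha : a ≤ b) (hc : b ≤ c) :
    m ^ (-b) ≤ m ^ (-a) + m ^ (-c) := by
  rcases le_total m 1 with h | h
  · have := Real.rpow_le_rpow_of_exponent_ge hm h (neg_le_neg hc)
    have h2 : 0 < m ^ (-a) := by positivity
    linarith
  · have := Real.rpow_le_rpow_of_exponent_le h (neg_le_neg ha)
    have h2 : 0 < m ^ (-c) := by positivity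
    linarith

variable {K : Type*} [NontriviallyNormedField K] [ProperSpace K]
variable [MeasurableSpace K] [BorelSpace K]

/-- The Mellin integrals of `h` converge absolutely in the strip `a < Re s < b`. -/
structure MellinStrip (μ : Measure K) (h : K → ℂ) (a b : ℝ) : Prop where
  aestronglyMeasurable : AEStronglyMeasurable h μ
  integrable : ∀ σ, a < σ → σ < b → Integrable (fun y => modulus y ^ (-σ) * ‖h y‖) μ

variable {μ : Measure K}

lemma MellinStrip.mono {h : K → ℂ} {a b a' b' : ℝ} (H : MellinStrip μ h a b) (ha : a ≤ a')
    (hb : b' ≤ b) : MellinStrip μ h a' b' :=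
  ⟨H.1, fun σ h1 h2 => H.2 σ (ha.trans_lt h1) (h2.trans_le hb)⟩

variable [μ.IsAddHaarMeasure]

lemma MellinStrip.integrable_mul {h : K → ℂ} {a b : ℝ} (H : MellinStrip μ h a b)
    (χ : Kˣ →ₜ* Circle) {s : ℂ} (hs : a < s.re) (hs' : s.re < b) :
    Integrable (fun y => h y * homogeneous χ s y) μ := by
  refine (H.2 _ hs hs').mono (H.1.mul (measurable_homogeneous χ s).aestronglyMeasurable) ?_
  filter_upwards [ae_ne_zero] with y hy
  rw [norm_mul, norm_homogeneous χ s hy, norm_mul, norm_norm,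
    Real.norm_of_nonneg (by have := modulus_nonneg y; positivity), mul_comm]

lemma MellinStrip.sub {h g : K → ℂ} {a b : ℝ} (H : MellinStrip μ h a b) (G : MellinStrip μ g a b) :
    MellinStrip μ (fun y => h y - g y) a b := by
  refine ⟨H.1.sub G.1, fun σ h1 h2 => ((H.2 σ h1 h2).add (G.2 σ h1 h2)).mono
    ((continuous_modulus.measurable.pow_const _).aestronglyMeasurable.mul (H.1.sub G.1).norm) ?_⟩
  refine Eventually.of_forall fun y => ?_
  have := modulus_nonneg y
  rw [Pi.add_apply, norm_mul, norm_norm, Real.norm_of_nonneg (by positivity),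
    Real.norm_of_nonneg (by positivity), ← mul_add]
  exact mul_le_mul_of_nonneg_left (norm_sub_le _ _) (by positivity)

lemma MellinStrip.add {h g : K → ℂ} {a b : ℝ} (H : MellinStrip μ h a b) (G : MellinStrip μ g a b) :
    MellinStrip μ (fun y => h y + g y) a b := by
  have hG : MellinStrip μ (fun y => -g y) a b :=
    ⟨G.1.neg, fun σ h1 h2 => by simpa using G.2 σ h1 h2⟩
  simpa using H.sub hG

/-- Pointwise majorant for `log |y| |y|^(-τ)`. -/
lemma abs_log_mul_rpow_le {m δ σ τ : ℝ} (hm : 0 < m) (hδ : 0 < δ) (h : |τ - σ| ≤ δ) :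
    |Real.log m| * m ^ (-τ) ≤
      (2 * δ⁻¹) * (m ^ (-(σ - 2 * δ)) + m ^ (-(σ + 2 * δ))) := by
  rw [abs_le] at h
  have e1 : m ^ δ * m ^ (-τ) = m ^ (-(τ - δ)) := by rw [← Real.rpow_add hm]; congr 1; ring
  have e2 : m ^ (-δ) * m ^ (-τ) = m ^ (-(τ + δ)) := by rw [← Real.rpow_add hm]; congr 1; ring
  have b1 := rpow_le_add_rpow hm (a := σ - 2 * δ) (b := τ - δ) (c := σ + 2 * δ)
    (by linarith) (by linarith)
  have b2 := rpow_le_add_rpow hm (a := σ - 2 * δ) (b := τ + δ) (c := σ + 2 * δ)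
    (by linarith) (by linarith)
  calc |Real.log m| * m ^ (-τ) ≤ (δ⁻¹ * (m ^ δ + m ^ (-δ))) * m ^ (-τ) := by
        gcongr; exact abs_log_le_rpow hm hδ
    _ = δ⁻¹ * (m ^ (-(τ - δ)) + m ^ (-(τ + δ))) := by rw [← e1, ← e2]; ring
    _ ≤ δ⁻¹ * (2 * (m ^ (-(σ - 2 * δ)) + m ^ (-(σ + 2 * δ)))) := by gcongr; linarith
    _ = _ := by ring

lemma aestronglyMeasurable_opA {h : K → ℂ} (hh : AEStronglyMeasurable h μ) :
    AEStronglyMeasurable (opA h) μ := by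
  have : Measurable fun y : K => (Real.log (modulus y) : ℂ) :=
    Complex.measurable_ofReal.comp (Real.measurable_log.comp continuous_modulus.measurable)
  exact this.aestronglyMeasurable.mul hh

lemma norm_opA (h : K → ℂ) (y : K) : ‖opA h y‖ = |Real.log (modulus y)| * ‖h y‖ := by
  rw [opA, norm_mul, Complex.norm_real, Real.norm_eq_abs]

/-- The margin is `2 * δ` because one `δ` pays for moving the exponent in a ball and another for
absorbing the logarithm. -/
lemma exists_strip_radius {a b σ : ℝ} (h1 : a < σ) (h2 : σ < b) :
    ∃ δ > 0, a < σ - 2 * δ ∧ σ + 2 * δ < b := by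
  refine ⟨min (σ - a) (b - σ) / 4, by have := lt_min (sub_pos.2 h1) (sub_pos.2 h2); positivity, ?_, ?_⟩
  · have := min_le_left (σ - a) (b - σ); linarith
  · have := min_le_right (σ - a) (b - σ); linarith

/-- A logarithm costs an arbitrarily small power in either direction, and the strip is open. -/
lemma MellinStrip.opA {h : K → ℂ} {a b : ℝ} (H : MellinStrip μ h a b) :
    MellinStrip μ (opA h) a b := by
  refine ⟨aestronglyMeasurable_opA H.1, fun σ h1 h2 => ?_⟩
  obtain ⟨δ, hδ, ha, hb⟩ := exists_strip_radius h1 h2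
  have I := ((H.2 _ ha (by linarith)).add (H.2 _ (by linarith) hb)).const_mul (2 * δ⁻¹)
  refine I.mono ((continuous_modulus.measurable.pow_const _).aestronglyMeasurable.mul
    (aestronglyMeasurable_opA H.1).norm) ?_
  filter_upwards [ae_ne_zero] with y hy
  have hm := modulus_pos hy
  rw [norm_mul, norm_norm, Real.norm_of_nonneg (by positivity), norm_opA]
  refine le_trans ?_ (le_abs_self _)
  have := abs_log_mul_rpow_le hm hδ (σ := σ) (τ := σ) (by simpa using hδ.le)
  calc modulus y ^ (-σ) * (|Real.log (modulus y)| * ‖h y‖)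
      = (|Real.log (modulus y)| * modulus y ^ (-σ)) * ‖h y‖ := by ring
    _ ≤ _ * ‖h y‖ := mul_le_mul_of_nonneg_right this (norm_nonneg _)
    _ = _ := by simp only [Pi.add_apply]; ring

/-- The Mellin transform `∫ h(y) χ⁻¹(y) |y|^(-s) dy`. -/
def mellinChar (μ : Measure K) (χ : Kˣ →ₜ* Circle) (h : K → ℂ) (s : ℂ) : ℂ :=
  ∫ y, h y * homogeneous χ s y ∂μ

lemma MellinStrip.hasDerivAt {h : K → ℂ} {a b : ℝ} (H : MellinStrip μ h a b)
    (χ : Kˣ →ₜ* Circle) {s : ℂ} (hs : a < s.re) (hs' : s.re < b) :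
    HasDerivAt (mellinChar μ χ h) (-mellinChar μ χ (LocalCommutator.opA h) s) s := by
  obtain ⟨δ, hδ, ha, hb⟩ := exists_strip_radius hs hs'
  have I := ((H.2 _ ha (by linarith)).add (H.2 _ (by linarith) hb)).const_mul (2 * δ⁻¹)
  rw [mellinChar, ← integral_neg]
  refine (hasDerivAt_integral_of_dominated_loc_of_deriv_le (𝕜 := ℂ)
    (F := fun z y => h y * homogeneous χ z y)
    (F' := fun z y => -(LocalCommutator.opA h y * homogeneous χ z y))
    (Metric.ball_mem_nhds s hδ) (Eventually.of_forall fun z =>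
      H.1.mul (measurable_homogeneous χ z).aestronglyMeasurable)
    (H.integrable_mul χ hs hs')
    ((aestronglyMeasurable_opA H.1).mul (measurable_homogeneous χ s).aestronglyMeasurable).neg
    ?_ I ?_).2
  · filter_upwards [ae_ne_zero] with y hy z hz
    have hm := modulus_pos hy
    have hz' : |z.re - s.re| ≤ δ := by
      rw [← Complex.sub_re]
      rw [Metric.mem_ball, dist_eq_norm] at hz
      exact (Complex.abs_re_le_norm _).trans hz.le
    have := abs_log_mul_rpow_le hm hδ hz'
    rw [norm_neg, norm_mul, norm_opA, norm_homogeneous χ z hy]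
    calc |Real.log (modulus y)| * ‖h y‖ * modulus y ^ (-z.re)
        = (|Real.log (modulus y)| * modulus y ^ (-z.re)) * ‖h y‖ := by ring
      _ ≤ _ * ‖h y‖ := mul_le_mul_of_nonneg_right this (norm_nonneg _)
      _ = _ := by simp only [Pi.add_apply]; ring
  · filter_upwards [ae_ne_zero] with y hy z hz
    have hm : (modulus y : ℂ) ≠ 0 := by exact_mod_cast (modulus_pos hy).ne'
    have h1 : HasDerivAt (fun z : ℂ => (modulus y : ℂ) ^ (-z))
        ((modulus y : ℂ) ^ (-z) * Complex.log (modulus y) * -1) z :=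
      (hasDerivAt_neg z).const_cpow (Or.inl hm)
    have h2 := (h1.const_mul (charFun χ y)⁻¹).const_mul (h y)
    convert! h2 using 1
    rw [LocalCommutator.opA, homogeneous, Complex.ofReal_log (modulus_nonneg y)]
    ring

end Strip

end LocalCommutator

end

noncomputable section

namespace LocalCommutator

open Filter Set
open scoped ENNReal NNReal Pointwise ContDiff

variable {K : Type*} [NontriviallyNormedField K]

/-! ### Uniqueness of the archimedean or ultrametric structure. -/

section FieldStructure

lemma not_isUltrametricDist_of_normedAlgebra_real [NormedAlgebra ℝ K] : ¬ IsUltrametricDist K := by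
  intro h
  have h1 : ‖(1 : K) + 1‖ ≤ max ‖(1 : K)‖ ‖(1 : K)‖ := IsUltrametricDist.norm_add_le_max 1 1
  have h2 : (1 : K) + 1 = algebraMap ℝ K 2 := by rw [map_ofNat]; norm_num
  rw [h2, norm_algebraMap'] at h1
  norm_num at h1

/-- Two structure maps from the reals are continuous and agree on the rationals. Since
`IsSchwartzBruhat` quantifies over the real structure, this is what allows two Schwartz functions to
be combined. -/
lemma subsingleton_normedAlgebra_real : Subsingleton (NormedAlgebra ℝ K) := by
  refine ⟨fun i j => ?_⟩
  have hc : ∀ k : NormedAlgebra ℝ K, Continuous (@algebraMap ℝ K _ _ k.toAlgebra) := fun k =>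
    @continuous_algebraMap ℝ K _ _ k.toAlgebra _ _ _
  have h : @algebraMap ℝ K _ _ i.toAlgebra = @algebraMap ℝ K _ _ j.toAlgebra := by
    ext x
    refine congrFun (Rat.isDenseEmbedding_coe_real.dense.equalizer (hc i) (hc j) ?_) x
    funext q
    simp only [Function.comp_apply]
    rw [map_ratCast (@algebraMap ℝ K _ _ i.toAlgebra), map_ratCast (@algebraMap ℝ K _ _ j.toAlgebra)]
  have h2 : i.toAlgebra = j.toAlgebra := Algebra.algebra_ext _ _ fun r => congrFun (congrArg _ h) r
  cases i
  cases j
  congr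

lemma isSchwartzBruhat_iff_of_ultrametric [IsUltrametricDist K] {f : K → ℂ} :
    IsSchwartzBruhat f ↔ IsLocallyConstant f ∧ HasCompactSupport f := by
  refine ⟨?_, fun h => Or.inl ⟨inferInstance, h⟩⟩
  rintro (h | ⟨i, -⟩)
  · exact h.2
  · exact absurd ‹_› (@not_isUltrametricDist_of_normedAlgebra_real K _ i)

lemma isSchwartzBruhat_iff_of_real [inst : NormedAlgebra ℝ K] {f : K → ℂ} :
    IsSchwartzBruhat f ↔ ∃ g : SchwartzMap K ℂ, ⇑g = f := by
  refine ⟨?_, fun h => Or.inr ⟨inferInstance, h⟩⟩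
  rintro (h | ⟨i, hi⟩)
  · exact absurd h.1 not_isUltrametricDist_of_normedAlgebra_real
  · have h : i = inst := subsingleton_normedAlgebra_real.elim _ _
    rwa [h] at hi

end FieldStructure

/-! ### Schwartz–Bruhat functions on ultrametric fields. -/

section Ultrametric

variable [IsUltrametricDist K]

/-- The circle has no small subgroups: as long as `w` is within `1/2` of `1`, `‖w + 1‖ ≥ 3/2`, so
squaring expands the distance to `1` by a factor at least `3/2`. -/
lemma circle_eq_one_of_norm_pow_sub_one_le {z : Circle} (h : ∀ n : ℕ, ‖((z ^ n : Circle) : ℂ) - 1‖ ≤ 1 / 2) :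
    z = 1 := by
  by_contra hz
  have hz' : 0 < ‖(z : ℂ) - 1‖ := by
    rw [norm_pos_iff, sub_ne_zero]
    exact fun h => hz (Circle.ext h)
  have key : ∀ k : ℕ, (3 / 2 : ℝ) ^ k * ‖(z : ℂ) - 1‖ ≤ ‖((z ^ (2 ^ k) : Circle) : ℂ) - 1‖ := by
    intro k
    induction k with
    | zero => simp
    | succ k ih =>
      set w : ℂ := ((z ^ (2 ^ k) : Circle) : ℂ) with hw
      have e1 : ((z ^ (2 ^ (k + 1)) : Circle) : ℂ) - 1 = (w + 1) * (w - 1) := by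
        rw [pow_succ, pow_mul, Circle.coe_pow, ← hw]; ring
      have e2 : (3 / 2 : ℝ) ≤ ‖w + 1‖ := by
        have h1 : ‖(2 : ℂ)‖ ≤ ‖w + 1‖ + ‖w - 1‖ := by
          calc ‖(2 : ℂ)‖ = ‖(w + 1) - (w - 1)‖ := by congr 1; ring
            _ ≤ _ := norm_sub_le _ _
        have h2 := h (2 ^ k)
        rw [← hw] at h2
        rw [Complex.norm_ofNat] at h1
        linarith
      rw [e1, norm_mul, pow_succ', mul_assoc]
      exact mul_le_mul e2 ih (by positivity) (by positivity)
  obtain ⟨k, hk⟩ := pow_unbounded_of_one_lt (1 / ‖(z : ℂ) - 1‖) (by norm_num : (1 : ℝ) < 3 / 2)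
  rw [div_lt_iff₀ hz'] at hk
  linarith [key k, h (2 ^ k)]

/-- In an ultrametric field, integer multiples do not increase the norm, so all powers of `e x` stay
near `1` when `x` is small. -/
lemma exists_ball_le_ker {e : AddChar K Circle} (he : Continuous e) :
    ∃ δ > 0, ∀ x : K, ‖x‖ < δ → e x = 1 := by
  have hc : ContinuousAt (fun x => ‖((e x : Circle) : ℂ) - 1‖) 0 := by fun_prop
  have h0 : ‖((e 0 : Circle) : ℂ) - 1‖ < 1 / 2 := by simp
  obtain ⟨δ, hδ, h⟩ := Metric.eventually_nhds_iff.1 (hc.eventually_lt_const h0)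
  refine ⟨δ, hδ, fun x hx => circle_eq_one_of_norm_pow_sub_one_le fun n => ?_⟩
  rw [← AddChar.map_nsmul_eq_pow]
  refine (h ?_).le
  rw [dist_zero_right, nsmul_eq_mul, norm_mul]
  exact (mul_le_of_le_one_left (norm_nonneg _) (IsUltrametricDist.norm_natCast_le_one K n)).trans_lt hx

lemma exists_uniform_locallyConstant [ProperSpace K] {f : K → ℂ} (hf : IsLocallyConstant f)
    (hc : HasCompactSupport f) : ∃ δ > 0, ∀ x h : K, ‖h‖ < δ → f (x + h) = f x := by
  obtain ⟨δ, hδ, H⟩ := lebesgue_number_lemma_of_metric (s := tsupport f) (c := fun c : ℂ => f ⁻¹' {c})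
    hc (fun c => hf.isOpen_fiber c) (fun x _ => mem_iUnion.2 ⟨f x, rfl⟩)
  have key : ∀ x ∈ tsupport f, ∀ h : K, ‖h‖ < δ → f (x + h) = f x := by
    intro x hx h hh
    obtain ⟨c, hcx⟩ := H x hx
    have h1 : f x = c := hcx (Metric.mem_ball_self hδ)
    have h2 : f (x + h) = c := hcx (by simpa using hh)
    rw [h1, h2]
  refine ⟨δ, hδ, fun x h hh => ?_⟩
  by_cases hx : x ∈ tsupport f
  · exact key x hx h hh
  by_cases hx' : x + h ∈ tsupport f
  · simpa using (key (x + h) hx' (-h) (by simpa using hh)).symm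
  rw [image_eq_zero_of_notMem_tsupport hx, image_eq_zero_of_notMem_tsupport hx']

variable [ProperSpace K] [MeasurableSpace K] [BorelSpace K] (μ : Measure K) [μ.IsAddHaarMeasure]

lemma isSchwartzBruhat_fourier_of_ultrametric {e : AddChar K Circle} (he : Continuous e)
    (he' : e ≠ 1) {f : K → ℂ} (hf : IsSchwartzBruhat f) :
    IsSchwartzBruhat (Fourier.fourierIntegral e μ f) := by
  rw [isSchwartzBruhat_iff_of_ultrametric] at hf ⊢
  obtain ⟨hl, hc⟩ := hf
  constructor
  · obtain ⟨δ, hδ, hker⟩ := exists_ball_le_ker he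
    obtain ⟨R, hR0, hR⟩ := hc.isCompact.isBounded.exists_pos_norm_le
    rw [IsLocallyConstant.iff_eventually_eq]
    intro x
    filter_upwards [Metric.ball_mem_nhds x (div_pos hδ hR0)] with y hy
    rw [Fourier.fourierIntegral_def, Fourier.fourierIntegral_def]
    refine integral_congr_ae (Eventually.of_forall fun v => ?_)
    by_cases hv : v ∈ tsupport f
    · have : -(v * y) = -(v * x) + v * (x - y) := by ring
      simp only
      rw [this, AddChar.map_add_eq_mul, hker (v * (x - y)), mul_one]
      rw [norm_mul]
      rw [Metric.mem_ball, dist_comm, dist_eq_norm, lt_div_iff₀ hR0] at hy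
      calc ‖v‖ * ‖x - y‖ ≤ R * ‖x - y‖ := by gcongr; exact hR v hv
        _ < δ := by linarith
    · simp [image_eq_zero_of_notMem_tsupport hv]
  · obtain ⟨δ, hδ, hinv⟩ := exists_uniform_locallyConstant hl hc
    obtain ⟨x₀, hx₀⟩ : ∃ x₀, e x₀ ≠ 1 := by
      by_contra! h
      exact he' (DFunLike.ext _ _ h)
    refine HasCompactSupport.intro (isCompact_closedBall (0 : K) (‖x₀‖ / δ)) fun w hw => ?_
    rw [mem_closedBall_zero_iff, not_le, div_lt_iff₀ hδ] at hw
    have hw0 : w ≠ 0 := by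
      rintro rfl
      simp at hw
      exact absurd hw (norm_nonneg _).not_gt
    by_contra hne
    refine hx₀ ?_
    -- For large `w`, translation by `x₀ / w` fixes `f` but multiplies its transform at `w` by `e x₀
    -- ≠ 1`, so the transform vanishes there.
    have h1 : (f ∘ fun v => v + x₀ / w) = f := by
      ext v
      refine hinv _ _ ?_
      rwa [norm_div, div_lt_iff₀ (norm_pos_iff.2 hw0), mul_comm]
    have h2 := congrFun (Fourier.fourierIntegral_comp_add_right e μ f (x₀ / w)) w
    rw [h1, div_mul_cancel₀ _ hw0, Circle.smul_def, smul_eq_mul] at h2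
    exact Circle.ext (mul_right_cancel₀ hne (by rw [← h2, Circle.coe_one, one_mul]))

/-- Off the origin an ultrametric norm, hence the modulus, is locally constant. -/
lemma isPuncturedTest_opA_of_ultrametric {f : K → ℂ} (hf : IsPuncturedTest f) :
    IsPuncturedTest (opA f) := by
  obtain ⟨h1, h2⟩ := hf
  rw [isSchwartzBruhat_iff_of_ultrametric] at h1
  have h0 : ∀ᶠ y in 𝓝 (0 : K), opA f y = 0 := h2.mono fun y hy => by simp [opA, hy]
  refine ⟨isSchwartzBruhat_iff_of_ultrametric.2 ⟨?_, ?_⟩, h0⟩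
  · rw [IsLocallyConstant.iff_eventually_eq]
    obtain ⟨d, -, hd⟩ := exists_modulus_eq_norm_rpow K
    intro y
    rcases eq_or_ne y 0 with rfl | hy
    · filter_upwards [h0] with z hz
      rw [hz, h0.self_of_nhds]
    · filter_upwards [(IsLocallyConstant.iff_eventually_eq f).1 h1.1 y,
        Metric.ball_mem_nhds y (norm_pos_iff.2 hy)] with z hz hz'
      have : ‖z‖ = ‖y‖ := by
        rw [Metric.mem_ball, dist_eq_norm] at hz'
        have := IsUltrametricDist.norm_add_eq_max_of_norm_ne_norm hz'.ne
        rwa [sub_add_cancel, max_eq_right hz'.le] at this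
      rw [opA, opA, hz, hd, hd, this]
  · exact h1.2.mul_left

end Ultrametric

end LocalCommutator

end

noncomputable section

namespace LocalCommutator

open Filter Set
open scoped ENNReal NNReal Pointwise ContDiff

/-! ### Schwartz functions on archimedean fields. -/

section Archimedean

/-- A continuous unitary character of a real vector space is `exp(2πi L)` for a linear form `L`. -/
lemma exists_linear_form {E : Type*} [NormedAddCommGroup E] [NormedSpace ℝ E]
    {e : AddChar E Circle} (he : Continuous e) :
    ∃ L : E →L[ℝ] ℝ, ∀ x, e x = Real.fourierChar (L x) := by
  obtain ⟨F, ⟨hF0, hF⟩, -⟩ := Circle.isCoveringMap_exp.existsUnique_continuousMap_lifts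
    (⟨e, he⟩ : C(E, Circle)) 0 0 (by simp)
  have hF' : ∀ x, Circle.exp (F x) = e x := fun x => congrFun hF x
  -- The additivity defect of the lift `F` is `2π` times a continuous integer-valued function on a
  -- connected space, and it vanishes at the origin.
  have hadd : ∀ x y, F (x + y) = F x + F y := by
    intro x y
    have hG : Continuous fun p : E × E => (F (p.1 + p.2) - F p.1 - F p.2) / (2 * Real.pi) := by
      fun_prop
    have hint : ∀ p : E × E, ∃ n : ℤ, (F (p.1 + p.2) - F p.1 - F p.2) / (2 * Real.pi) = n := by
      intro p
      have h1 : Circle.exp (F (p.1 + p.2) - F p.1 - F p.2) = 1 := by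
        rw [Circle.exp_sub, Circle.exp_sub, hF', hF', hF', AddChar.map_add_eq_mul]
        simp
      obtain ⟨n, hn⟩ := Circle.exp_eq_one.1 h1
      exact ⟨n, by rw [hn]; field_simp⟩
    choose n hn using hint
    have hnc : Continuous fun p => ((n p : ℤ) : ℝ) := by simpa only [← hn] using hG
    have hnc' : Continuous n := Int.isClosedEmbedding_coe_real.isEmbedding.continuous_iff.2 hnc
    have h0 : n (x, y) = n (0, 0) := PreconnectedSpace.constant inferInstance hnc'
    have h1 := hn (x, y)
    have h2 := hn (0, 0)
    simp only [add_zero, hF0, sub_zero, zero_div] at h2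
    rw [h0, ← h2, div_eq_zero_iff] at h1
    rcases h1 with h1 | h1
    · simp only at h1; linarith
    · exact absurd h1 (by positivity)
  let A : E →+ ℝ := AddMonoidHom.mk' F hadd
  let L : E →L[ℝ] ℝ := A.toRealLinearMap F.continuous
  refine ⟨(2 * Real.pi)⁻¹ • L, fun x => ?_⟩
  rw [Real.fourierChar_apply', ← hF' x]
  congr 1
  change F x = 2 * Real.pi * ((2 * Real.pi)⁻¹ * F x)
  field_simp

variable {K : Type*} [NontriviallyNormedField K] [ProperSpace K] [NormedAlgebra ℝ K]

variable (K) in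
lemma finiteDimensional_real : FiniteDimensional ℝ K :=
  FiniteDimensional.of_locallyCompactSpace ℝ

-- This replaces the norm of `K` by a Euclidean one, so that `‖y‖ ^ 2` is visibly smooth.
variable (K) in
lemma exists_norm_preserving_complex : ∃ φ : K →L[ℝ] ℂ, ∀ x, ‖φ x‖ = ‖x‖ := by
  have := finiteDimensional_real K
  have key : ∀ ψ : K →ₐ[ℝ] ℂ, ∀ x, ‖ψ x‖ = ‖x‖ := by
    intro ψ
    let φ : K →L[ℝ] ℂ := LinearMap.toContinuousLinearMap ψ.toLinearMap
    -- A multiplicative map bounded by a constant times the norm is bounded by the norm itself: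
    -- apply the bound to `x ^ n`.
    have le : ∀ x, ‖ψ x‖ ≤ ‖x‖ := by
      intro x
      by_contra! hx
      have hx0 : x ≠ 0 := by
        rintro rfl
        simp at hx
      have h1 : 1 < ‖ψ x‖ / ‖x‖ := (one_lt_div (norm_pos_iff.2 hx0)).2 hx
      obtain ⟨n, hn⟩ := pow_unbounded_of_one_lt ‖φ‖ h1
      have h2 := φ.le_opNorm (x ^ n)
      have h3 : φ (x ^ n) = ψ x ^ n := map_pow ψ x n
      rw [h3, norm_pow, norm_pow] at h2
      rw [div_pow, lt_div_iff₀ (by positivity)] at hn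
      linarith
    intro x
    refine le_antisymm (le x) ?_
    rcases eq_or_ne x 0 with rfl | hx
    · simp
    have h := le x⁻¹
    rw [map_inv₀, norm_inv, norm_inv] at h
    have hψ : ψ x ≠ 0 := (map_ne_zero ψ).2 hx
    exact (inv_le_inv₀ (norm_pos_iff.2 hψ) (norm_pos_iff.2 hx)).1 h
  have : Nonempty (K →ₐ[ℝ] ℂ) := by
    rcases NormedAlgebra.Real.nonempty_algEquiv_or K with ⟨⟨f⟩⟩ | ⟨⟨f⟩⟩
    · exact ⟨(Algebra.ofId ℝ ℂ).comp f.toAlgHom⟩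
    · exact ⟨f.toAlgHom⟩
  obtain ⟨ψ⟩ := this
  exact ⟨LinearMap.toContinuousLinearMap ψ.toLinearMap, key ψ⟩

lemma iteratedDeriv_log_bound {c : ℝ} (hc : 0 < c) (n : ℕ) :
    ∃ C : ℝ, 0 ≤ C ∧ ∀ x ∈ Ioi c, ‖iteratedDeriv n Real.log x‖ ≤ C * (1 + ‖x‖) ^ 1 := by
  cases n with
  | zero =>
    refine ⟨1 + c⁻¹, by positivity, fun x hx => ?_⟩
    have hx' : 0 < x := hc.trans hx
    rw [iteratedDeriv_zero, pow_one, Real.norm_eq_abs, Real.norm_of_nonneg hx'.le]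
    have h1 := abs_log_le_rpow hx' one_pos
    rw [Real.rpow_one, Real.rpow_neg_one, inv_one, one_mul] at h1
    have h2 : x⁻¹ ≤ c⁻¹ := inv_anti₀ hc (le_of_lt hx)
    have h3 : 0 ≤ c⁻¹ * x := by positivity
    linarith
  | succ n =>
    refine ⟨n.factorial * c ^ (-1 - n : ℤ), by positivity, fun x hx => ?_⟩
    have hx' : 0 < x := hc.trans hx
    rw [iteratedDeriv_succ', Real.deriv_log', iteratedDeriv_eq_iterate]
    have h0 : deriv^[n] (fun x : ℝ => x⁻¹) x = (-1) ^ n * n.factorial * x ^ (-1 - n : ℤ) :=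
      iter_deriv_inv n x
    rw [h0, norm_mul, norm_mul, norm_pow, norm_neg, norm_one, one_pow, one_mul, Real.norm_natCast,
      pow_one, norm_zpow, Real.norm_of_nonneg hx'.le]
    have h1 : x ^ (-1 - n : ℤ) ≤ c ^ (-1 - n : ℤ) := by
      rw [show (-1 - n : ℤ) = -((n + 1 : ℕ) : ℤ) by push_cast; ring, zpow_neg, zpow_neg,
        zpow_natCast, zpow_natCast]
      exact inv_anti₀ (by positivity) (pow_le_pow_left₀ hc.le (le_of_lt hx) _)
    have h2 : (0 : ℝ) ≤ n.factorial * c ^ (-1 - n : ℤ) := by positivity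
    calc (n.factorial : ℝ) * x ^ (-1 - n : ℤ) ≤ n.factorial * c ^ (-1 - n : ℤ) := by gcongr
      _ ≤ _ := le_mul_of_one_le_right h2 (by linarith)

lemma hasTemperateGrowth_log_comp {E : Type*} [NormedAddCommGroup E] [NormedSpace ℝ E] {q : E → ℝ}
    (hq : q.HasTemperateGrowth) {c : ℝ} (hc : 0 < c) (h : ∀ x, c < q x) :
    (Real.log ∘ q).HasTemperateGrowth := by
  refine Function.HasTemperateGrowth.comp' (t := Ioi c) (range_subset_iff.2 h)
    isOpen_Ioi.uniqueDiffOn ?_ ?_ hq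
  · intro x hx
    exact (Real.contDiffAt_log.2 (hc.trans hx).ne').contDiffWithinAt
  · intro N
    choose C hC0 hC using iteratedDeriv_log_bound hc
    refine ⟨1, ∑ n ∈ Finset.range (N + 1), C n, Finset.sum_nonneg fun n _ => hC0 n,
      fun n hn x hx => ?_⟩
    rw [iteratedFDerivWithin_of_isOpen n isOpen_Ioi hx, norm_iteratedFDeriv_eq_norm_iteratedDeriv]
    refine (hC n x hx).trans ?_
    gcongr
    exact Finset.single_le_sum (f := C) (fun n _ => hC0 n) (Finset.mem_range_succ_iff.2 hn)

lemma isPuncturedTest_opA_of_real {f : K → ℂ} (hf : IsPuncturedTest f) :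
    IsPuncturedTest (opA f) := by
  obtain ⟨h1, h2⟩ := hf
  have h0 : ∀ᶠ y in 𝓝 (0 : K), opA f y = 0 := h2.mono fun y hy => by simp [opA, hy]
  refine ⟨?_, h0⟩
  obtain ⟨g, rfl⟩ := isSchwartzBruhat_iff_of_real.1 h1
  have := finiteDimensional_real K
  obtain ⟨r, hr, hg⟩ := Metric.eventually_nhds_iff.1 h2
  obtain ⟨φ, hφ⟩ := exists_norm_preserving_complex K
  obtain ⟨d, -, hd⟩ := exists_modulus_eq_norm_rpow K
  -- `log |y|` is `(d / 2) log (‖y‖ ^ 2)`. Adding a bump supported where `g` vanishes keeps the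
  -- argument of the logarithm away from zero without changing the product with `g`.
  let η : ContDiffBump (0 : K) := ⟨r / 4, r / 2, by positivity, by linarith⟩
  let q : K → ℝ := fun y => ‖φ y‖ ^ 2 + η y
  have hq : q.HasTemperateGrowth := by
    refine Function.HasTemperateGrowth.add ?_ (η.hasCompactSupport.hasTemperateGrowth η.contDiff)
    exact (Function.hasTemperateGrowth_norm_sq ℂ).comp φ.hasTemperateGrowth
  have hqc : ∀ y, min (1 / 2) ((r / 4) ^ 2 / 2) < q y := by
    intro y
    rcases lt_or_ge ‖y‖ (r / 4) with hy | hy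
    · have : η y = 1 := η.one_of_mem_closedBall (by simpa using hy.le)
      refine (min_le_left _ _).trans_lt ?_
      simp only [q, this]
      have : 0 ≤ ‖φ y‖ ^ 2 := by positivity
      linarith
    · refine (min_le_right _ _).trans_lt ?_
      simp only [q, hφ]
      have h1 : (r / 4) ^ 2 ≤ ‖y‖ ^ 2 := by gcongr
      have h2 := η.nonneg (x := y)
      have h3 : 0 < (r / 4) ^ 2 := by positivity
      linarith
  have hl := hasTemperateGrowth_log_comp hq (by positivity) hqc
  refine isSchwartzBruhat_iff_of_real.2
    ⟨(d / 2) • SchwartzMap.smulLeftCLM ℂ (Real.log ∘ q) g, ?_⟩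
  ext y
  rw [smul_apply, SchwartzMap.smulLeftCLM_apply_apply hl, opA]
  rcases lt_or_ge ‖y‖ r with hy | hy
  · rw [hg (by simpa using hy)]; simp
  · have hη : η y = 0 := by
      refine η.zero_of_le_dist ?_
      rw [dist_zero_right]
      change r / 2 ≤ ‖y‖
      linarith
    have hy0 : 0 < ‖y‖ := hr.trans_le hy
    simp only [Function.comp_apply, q, hη, add_zero, hφ, hd]
    rw [Real.log_pow, Real.log_rpow hy0]
    simp only [Complex.real_smul]
    push_cast
    ring

variable [MeasurableSpace K] [BorelSpace K] (μ : Measure K) [μ.IsAddHaarMeasure]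

lemma isSchwartzBruhat_fourier_of_real {e : AddChar K Circle} (he : Continuous e)
    (he' : e ≠ 1) {f : K → ℂ} (hf : IsSchwartzBruhat f) :
    IsSchwartzBruhat (Fourier.fourierIntegral e μ f) := by
  have := finiteDimensional_real K
  obtain ⟨g, rfl⟩ := isSchwartzBruhat_iff_of_real.1 hf
  obtain ⟨ℓ, hℓ⟩ := exists_linear_form he
  obtain ⟨v₀, hv₀⟩ : ∃ v, ℓ v ≠ 0 := by
    by_contra! h
    refine he' (DFunLike.ext _ _ fun x => ?_)
    rw [hℓ, h]
    simp
  let L : K →L[ℝ] K →L[ℝ] ℝ := (ContinuousLinearMap.compL ℝ K K ℝ ℓ).comp (ContinuousLinearMap.mul ℝ K)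
  have hL : ∀ v w, L v w = ℓ (v * w) := fun v w => rfl
  have hF : Fourier.fourierIntegral e μ g =
      VectorFourier.fourierIntegral Real.fourierChar μ L.toLinearMap₁₂ g := by
    ext w
    rw [Fourier.fourierIntegral_def]
    refine integral_congr_ae (Eventually.of_forall fun v => ?_)
    simp only
    rw [hℓ, map_neg]
    rfl
  have hint : ∀ k n : ℕ, Integrable (fun v => ‖v‖ ^ k * ‖iteratedFDeriv ℝ n g v‖) μ :=
    fun k n => g.integrable_pow_mul_iteratedFDeriv μ k n
  refine isSchwartzBruhat_iff_of_real.2 ⟨⟨Fourier.fourierIntegral e μ g, ?_, ?_⟩, rfl⟩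
  · rw [hF]
    exact VectorFourier.contDiff_fourierIntegral L (N := ⊤)
      (fun n _ => g.integrable_pow_mul μ n)
  · intro k n
    let C := ‖v₀‖ ^ k * (2 * Real.pi * ‖L‖) ^ n * (2 * n + 2) ^ k *
        ∑ p ∈ Finset.range (n + 1) ×ˢ Finset.range (k + 1),
          ∫ v, ‖v‖ ^ p.1 * ‖iteratedFDeriv ℝ p.2 g v‖ ∂μ
    have hC : 0 ≤ C := by
      refine mul_nonneg (by positivity) (Finset.sum_nonneg fun p _ => integral_nonneg fun v => ?_)
      positivity
    have key : ∀ w ≠ 0, ‖w‖ ^ k * ‖iteratedFDeriv ℝ n (Fourier.fourierIntegral e μ g) w‖ ≤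
        C / |ℓ v₀| ^ k := by
      intro w hw
      have hw' := norm_pos_iff.2 hw
      -- The direction depends on `w`: this vector has the norm of `v₀` and pairs with `w` to `‖w‖ *
      -- ℓ v₀`, so the general estimate yields decay in every direction at once.
      have h := VectorFourier.pow_mul_norm_iteratedFDeriv_fourierIntegral_le L (μ := μ) (K := ⊤)
        (N := ⊤) (g.smooth ⊤) (fun k n _ _ => hint k n) (k := n) (n := k) le_top le_top
        (‖w‖ • (v₀ * w⁻¹)) w
      rw [← hF, hL, smul_mul_assoc, inv_mul_cancel_right₀ hw, map_smul, smul_eq_mul, abs_mul,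
        abs_norm, norm_smul, norm_mul, norm_inv, norm_norm,
        mul_comm ‖v₀‖, mul_inv_cancel_left₀ hw'.ne', mul_pow] at h
      rw [le_div_iff₀ (by positivity)]
      calc _ = ‖w‖ ^ k * |ℓ v₀| ^ k * ‖iteratedFDeriv ℝ n (Fourier.fourierIntegral e μ g) w‖ := by
            ring
        _ ≤ C := h
    refine ⟨C / |ℓ v₀| ^ k + ‖(0 : K)‖ ^ k *
      ‖iteratedFDeriv ℝ n (Fourier.fourierIntegral e μ g) 0‖, fun w => ?_⟩
    rcases eq_or_ne w 0 with rfl | hw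
    · have : 0 ≤ C / |ℓ v₀| ^ k := by positivity
      linarith
    · have : 0 ≤ ‖(0 : K)‖ ^ k * ‖iteratedFDeriv ℝ n (Fourier.fourierIntegral e μ g) 0‖ := by
        positivity
      linarith [key w hw]

end Archimedean

end LocalCommutator

end

noncomputable section

namespace LocalCommutator

open Filter Set
open scoped ENNReal NNReal Pointwise ContDiff

variable {K : Type*} [NontriviallyNormedField K] [ProperSpace K]
  [hK : Fact (IsUltrametricDist K ∨ Nonempty (NormedAlgebra ℝ K))]

/-! ### Common properties of Schwartz–Bruhat functions over both kinds of field. -/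

section SchwartzBruhat

lemma IsSchwartzBruhat.continuous {f : K → ℂ} (hf : IsSchwartzBruhat f) : Continuous f := by
  rcases hf with ⟨-, h, -⟩ | ⟨i, g, rfl⟩
  · exact h.continuous
  · exact g.continuous

lemma IsSchwartzBruhat.sub {f g : K → ℂ} (hf : IsSchwartzBruhat f) (hg : IsSchwartzBruhat g) :
    IsSchwartzBruhat (fun y => f y - g y) := by
  rcases hK.out with h | ⟨⟨i⟩⟩
  · rw [isSchwartzBruhat_iff_of_ultrametric] at hf hg ⊢
    exact ⟨hf.1.sub hg.1, hf.2.sub hg.2⟩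
  · rw [isSchwartzBruhat_iff_of_real] at hf hg ⊢
    obtain ⟨f, rfl⟩ := hf
    obtain ⟨g, rfl⟩ := hg
    exact ⟨f - g, rfl⟩

lemma IsSchwartzBruhat.const_mul {f : K → ℂ} (hf : IsSchwartzBruhat f) (c : ℂ) :
    IsSchwartzBruhat (fun y => c * f y) := by
  rcases hK.out with h | ⟨⟨i⟩⟩
  · rw [isSchwartzBruhat_iff_of_ultrametric] at hf ⊢
    exact ⟨(IsLocallyConstant.const c).mul hf.1, hf.2.mul_left⟩
  · rw [isSchwartzBruhat_iff_of_real] at hf ⊢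
    obtain ⟨f, rfl⟩ := hf
    exact ⟨c • f, rfl⟩

lemma IsSchwartzBruhat.comp_add_right {f : K → ℂ} (hf : IsSchwartzBruhat f) (a : K) :
    IsSchwartzBruhat (fun y => f (y + a)) := by
  rcases hK.out with h | ⟨⟨i⟩⟩
  · rw [isSchwartzBruhat_iff_of_ultrametric] at hf ⊢
    exact ⟨hf.1.comp_continuous (by fun_prop), hf.2.comp_homeomorph (Homeomorph.addRight a)⟩
  · rw [isSchwartzBruhat_iff_of_real] at hf ⊢
    obtain ⟨f, rfl⟩ := hf
    refine ⟨SchwartzMap.compSubConstCLM ℝ (-a) f, ?_⟩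
    ext y
    simp

lemma IsSchwartzBruhat.fourier [MeasurableSpace K] [BorelSpace K] (μ : Measure K)
    [μ.IsAddHaarMeasure] {e : AddChar K Circle} (he : Continuous e)
    (he' : e ≠ 1) {f : K → ℂ} (hf : IsSchwartzBruhat f) :
    IsSchwartzBruhat (Fourier.fourierIntegral e μ f) := by
  rcases hK.out with h | ⟨⟨i⟩⟩
  · exact isSchwartzBruhat_fourier_of_ultrametric μ he he' hf
  · exact isSchwartzBruhat_fourier_of_real μ he he' hf

lemma IsSchwartzBruhat.decay {f : K → ℂ} (hf : IsSchwartzBruhat f) (k : ℕ) :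
    ∃ C : ℝ, 0 ≤ C ∧ ∀ y, modulus y ^ k * ‖f y‖ ≤ C := by
  suffices ∃ C : ℝ, ∀ y, modulus y ^ k * ‖f y‖ ≤ C by
    obtain ⟨C, hC⟩ := this
    exact ⟨C, (by have := modulus_nonneg (0 : K); positivity : (0 : ℝ) ≤ _).trans (hC 0), hC⟩
  rcases hK.out with h | ⟨⟨i⟩⟩
  · have hc := (isSchwartzBruhat_iff_of_ultrametric.1 hf).2
    have h1 : Continuous fun y => modulus y ^ k * ‖f y‖ :=
      (continuous_modulus.pow k).mul hf.continuous.norm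
    have h2 : HasCompactSupport fun y => modulus y ^ k * ‖f y‖ := hc.norm.mul_left
    obtain ⟨C, hC⟩ := h1.bounded_above_of_compact_support h2
    exact ⟨C, fun y => (le_abs_self _).trans (hC y)⟩
  · obtain ⟨g, rfl⟩ := isSchwartzBruhat_iff_of_real.1 hf
    obtain ⟨d, hd, h⟩ := exists_modulus_eq_norm_rpow K
    obtain ⟨C₀, -, hC₀⟩ := g.decay 0 0
    obtain ⟨C, -, hC⟩ := g.decay ⌈d * k⌉₊ 0
    refine ⟨C₀ + C, fun y => ?_⟩
    have e1 : modulus y ^ k ≤ 1 + ‖y‖ ^ ⌈d * k⌉₊ := by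
      rw [h, ← Real.rpow_mul_natCast (norm_nonneg y)]
      rcases le_total ‖y‖ 1 with hy | hy
      · have : ‖y‖ ^ (d * k) ≤ 1 := Real.rpow_le_one (norm_nonneg y) hy (by positivity)
        have : 0 ≤ ‖y‖ ^ ⌈d * k⌉₊ := by positivity
        linarith
      · have := Real.rpow_le_rpow_of_exponent_le hy (Nat.le_ceil (d * k))
        rw [Real.rpow_natCast] at this
        linarith
    have h0 := hC₀ y
    have h1 := hC y
    simp only [norm_iteratedFDeriv_zero, pow_zero, one_mul] at h0 h1
    calc _ ≤ (1 + ‖y‖ ^ ⌈d * k⌉₊) * ‖g y‖ := by gcongr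
      _ ≤ _ := by linarith

lemma IsSchwartzBruhat.lipschitz_at_zero {f : K → ℂ} (hf : IsSchwartzBruhat f) :
    ∃ C : ℝ, 0 ≤ C ∧ ∀ y, ‖f y - f 0‖ ≤ C * ‖y‖ := by
  rcases hK.out with h | ⟨⟨i⟩⟩
  · have hf' := isSchwartzBruhat_iff_of_ultrametric.1 hf
    obtain ⟨δ, hδ, H⟩ := exists_uniform_locallyConstant hf'.1 hf'.2
    obtain ⟨C, hC0, hC⟩ := hf.decay 0
    refine ⟨2 * C / δ, by positivity, fun y => ?_⟩
    rcases lt_or_ge ‖y‖ δ with hy | hy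
    · have := H 0 y hy
      rw [zero_add] at this
      rw [this, sub_self, norm_zero]
      positivity
    · have h1 := hC y
      have h2 := hC 0
      rw [pow_zero, one_mul] at h1 h2
      calc ‖f y - f 0‖ ≤ ‖f y‖ + ‖f 0‖ := norm_sub_le _ _
        _ ≤ 2 * C := by linarith
        _ = 2 * C / δ * δ := by field_simp
        _ ≤ _ := by gcongr
  · obtain ⟨g, rfl⟩ := isSchwartzBruhat_iff_of_real.1 hf
    obtain ⟨C, hC0, hC⟩ := g.decay 0 1
    refine ⟨C, hC0.le, fun y => ?_⟩
    have := convex_univ.norm_image_sub_le_of_norm_fderiv_le (𝕜 := ℝ) (f := g) (C := C)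
      (fun x _ => g.differentiableAt) (fun x _ => by
        have := hC x
        rwa [norm_iteratedFDeriv_one, pow_zero, one_mul] at this) (mem_univ (0 : K)) (mem_univ y)
    simpa using this

lemma IsPuncturedTest.opA {f : K → ℂ} (hf : IsPuncturedTest f) : IsPuncturedTest (opA f) := by
  borelize K
  rcases hK.out with h | ⟨⟨i⟩⟩
  · exact isPuncturedTest_opA_of_ultrametric hf
  · exact isPuncturedTest_opA_of_real hf

lemma IsPuncturedTest.sub {f g : K → ℂ} (hf : IsPuncturedTest f) (hg : IsPuncturedTest g) :
    IsPuncturedTest (fun y => f y - g y) :=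
  ⟨hf.1.sub hg.1, by filter_upwards [hf.2, hg.2] with y h1 h2; rw [h1, h2, sub_zero]⟩

lemma IsPuncturedTest.const_mul {f : K → ℂ} (hf : IsPuncturedTest f) (c : ℂ) :
    IsPuncturedTest (fun y => c * f y) :=
  ⟨hf.1.const_mul c, by filter_upwards [hf.2] with y h1; rw [h1, mul_zero]⟩

lemma IsPuncturedTest.at_zero {f : K → ℂ} (hf : IsPuncturedTest f) : f 0 = 0 :=
  hf.2.self_of_nhds

/-- Non-negative test functions concentrated near `1`. -/
lemma exists_bump {U : Set K} (hU : U ∈ 𝓝 (1 : K)) :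
    ∃ f : K → ℝ, IsPuncturedTest (fun y => (f y : ℂ)) ∧
      HasCompactSupport (fun y => (f y : ℂ)) ∧ (∀ y, 0 ≤ f y) ∧ f 1 = 1 ∧
        ∀ y, f y ≠ 0 → y ∈ U := by
  obtain ⟨r, hr, hrU⟩ := Metric.mem_nhds_iff.1 hU
  set ρ := min r 1 with hρ
  have hρ0 : 0 < ρ := lt_min hr one_pos
  have hball : Metric.ball (1 : K) ρ ⊆ U := (Metric.ball_subset_ball (min_le_left _ _)).trans hrU
  suffices ∃ f : K → ℝ, IsSchwartzBruhat (fun y => (f y : ℂ)) ∧ (∀ y, 0 ≤ f y) ∧ f 1 = 1 ∧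
      ∀ y, f y ≠ 0 → y ∈ Metric.ball (1 : K) (ρ / 2) by
    obtain ⟨f, h1, h2, h3, h4⟩ := this
    refine ⟨f, ⟨h1, ?_⟩, ?_, h2, h3, fun y hy =>
      hball (Metric.ball_subset_ball (by linarith) (h4 y hy))⟩
    · filter_upwards [Metric.ball_mem_nhds (0 : K) (by norm_num : (0 : ℝ) < 1 / 2)] with y hy
      by_contra hne
      have h5 := h4 y (by exact_mod_cast hne)
      rw [Metric.mem_ball, dist_eq_norm, norm_sub_rev] at h5
      rw [mem_ball_zero_iff] at hy
      have h6 : ‖(1 : K)‖ ≤ ‖1 - y‖ + ‖y‖ := by simpa using norm_add_le (1 - y) y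
      rw [norm_one] at h6
      have h7 : ρ ≤ 1 := min_le_right _ _
      linarith
    · refine HasCompactSupport.intro (isCompact_closedBall (1 : K) (ρ / 2)) fun y hy => ?_
      by_contra hne
      exact hy (Metric.ball_subset_closedBall (h4 y (by exact_mod_cast hne)))
  rcases hK.out with h | ⟨⟨i⟩⟩
  · classical
    refine ⟨(Metric.ball (1 : K) (ρ / 2)).indicator 1, ?_, ?_, ?_, ?_⟩
    · refine isSchwartzBruhat_iff_of_ultrametric.2 ⟨?_, ?_⟩
      · have hcl := IsUltrametricDist.isClopen_ball (1 : K) (ρ / 2)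
        rw [IsLocallyConstant.iff_eventually_eq]
        intro y
        by_cases hy : y ∈ Metric.ball (1 : K) (ρ / 2)
        · filter_upwards [hcl.isOpen.mem_nhds hy] with z hz
          rw [indicator_of_mem hz, indicator_of_mem hy, Pi.one_apply, Pi.one_apply]
        · filter_upwards [hcl.compl.isOpen.mem_nhds hy] with z hz
          rw [indicator_of_notMem hz, indicator_of_notMem hy]
      · refine HasCompactSupport.intro (isCompact_closedBall (1 : K) (ρ / 2)) fun y hy => ?_
        rw [indicator_of_notMem fun h => hy (Metric.ball_subset_closedBall h), Complex.ofReal_zero]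
    · exact fun y => indicator_nonneg (fun _ _ => zero_le_one) y
    · simp [hρ0]
    · intro y hy
      by_contra hne
      exact hy (indicator_of_notMem hne _)
  · have := finiteDimensional_real K
    let η : ContDiffBump (1 : K) := ⟨ρ / 4, ρ / 2, by positivity, by linarith⟩
    refine ⟨η, isSchwartzBruhat_iff_of_real.2 ⟨HasCompactSupport.toSchwartzMap
      (f := fun y => ((η y : ℝ) : ℂ)) ?_ ?_, rfl⟩, fun y => η.nonneg, ?_, ?_⟩
    · exact η.hasCompactSupport.comp_left Complex.ofReal_zero
    · exact Complex.ofRealCLM.contDiff.comp η.contDiff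
    · exact η.one_of_mem_closedBall (by simp [η]; positivity)
    · intro y hy
      by_contra hne
      exact hy (η.zero_of_le_dist (by simpa [η] using hne))

end SchwartzBruhat

end LocalCommutator

end

noncomputable section

namespace LocalCommutator

open Filter Set
open scoped ENNReal NNReal Pointwise ContDiff

variable {K : Type*} [NontriviallyNormedField K] [ProperSpace K]
variable [MeasurableSpace K] [BorelSpace K] {μ : Measure K} [μ.IsAddHaarMeasure]

/-! ### Mellin strips of Schwartz–Bruhat functions. -/

section Strips

lemma MellinStrip.of_bounds {h : K → ℂ} (hm : AEStronglyMeasurable h μ) {α β C : ℝ}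
    (h1 : ∀ y ≠ 0, ‖h y‖ ≤ C * modulus y ^ (-α)) (h2 : ∀ y ≠ 0, ‖h y‖ ≤ C * modulus y ^ (-β)) :
    MellinStrip μ h (1 - β) (1 - α) := by
  refine ⟨hm, fun σ hσ hσ' => integrable_of_modulus_bounds (a := σ + α) (b := σ + β) (C := C)
    ((continuous_modulus.measurable.pow_const _).aestronglyMeasurable.mul hm.norm) (by linarith)
    (by linarith) (fun y hy => ?_) (fun y hy => ?_)⟩
  all_goals
    have hy' := modulus_pos hy
    rw [norm_mul, norm_norm, Real.norm_of_nonneg (by positivity), neg_add, Real.rpow_add hy',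
      mul_left_comm]
    gcongr
    first | exact h1 y hy | exact h2 y hy

variable [hK : Fact (IsUltrametricDist K ∨ Nonempty (NormedAlgebra ℝ K))]

lemma IsSchwartzBruhat.mellinStrip {f : K → ℂ} (hf : IsSchwartzBruhat f) (a : ℝ) :
    MellinStrip μ f a 1 := by
  obtain ⟨C, hC0, hC⟩ := hf.decay 0
  obtain ⟨n, hn⟩ := exists_nat_gt (1 - a)
  obtain ⟨C', hC0', hC'⟩ := hf.decay n
  have := MellinStrip.of_bounds (μ := μ) (α := 0) (β := n) (C := C + C') (h := f)
    hf.continuous.aestronglyMeasurable (fun y hy => ?_) (fun y hy => ?_)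
  · exact this.mono (by linarith) (by simp)
  · have := hC y
    simp only [pow_zero, one_mul] at this
    simp only [neg_zero, Real.rpow_zero, mul_one]
    linarith
  · have hy' := modulus_pos hy
    rw [Real.rpow_neg hy'.le, Real.rpow_natCast, ← div_eq_mul_inv, le_div_iff₀ (by positivity)]
    linarith [hC' y]

lemma IsSchwartzBruhat.integrable {f : K → ℂ} (hf : IsSchwartzBruhat f) : Integrable f μ := by
  have h := (hf.mellinStrip (μ := μ) (-1)).2 0 (by norm_num) (by norm_num)
  simp only [neg_zero, Real.rpow_zero, one_mul] at h
  exact (integrable_norm_iff hf.continuous.aestronglyMeasurable).1 h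

-- Vanishing at the origin to first order in the norm gains the power `|y|^(1/d)`. The strip then
-- extends beyond `Re s = 1`, the point at which the transform of `log |x|` is computed.
variable (μ) in
lemma exists_wide_strip : ∃ ε : ℝ, 0 < ε ∧ (∀ y : K, ‖y‖ = modulus y ^ ε) ∧
    ∀ f : K → ℂ, IsSchwartzBruhat f → f 0 = 0 → ∀ a, MellinStrip μ f a (1 + ε) := by
  obtain ⟨d, hd, h⟩ := exists_modulus_eq_norm_rpow K
  have hn : ∀ y : K, ‖y‖ = modulus y ^ d⁻¹ := fun y => by
    rw [h, Real.rpow_rpow_inv (norm_nonneg y) hd.ne']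
  refine ⟨d⁻¹, by positivity, hn, fun f hf hf0 a => ?_⟩
  obtain ⟨C, hC0, hC⟩ := hf.lipschitz_at_zero
  obtain ⟨n, hn'⟩ := exists_nat_gt (1 - a)
  obtain ⟨C', hC0', hC'⟩ := hf.decay n
  have := MellinStrip.of_bounds (μ := μ) (α := -d⁻¹) (β := n) (C := C + C') (h := f)
    hf.continuous.aestronglyMeasurable (fun y hy => ?_) (fun y hy => ?_)
  · exact this.mono (by linarith) (by simp)
  · have := hC y
    rw [hf0, sub_zero, hn] at this
    have h2 : 0 ≤ C' * modulus y ^ d⁻¹ := mul_nonneg hC0' (Real.rpow_nonneg (modulus_nonneg y) _)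
    rw [neg_neg]
    linarith
  · have hy' := modulus_pos hy
    rw [Real.rpow_neg hy'.le, Real.rpow_natCast, ← div_eq_mul_inv, le_div_iff₀ (by positivity)]
    linarith [hC' y]

end Strips

/-! ### Parseval for dilates and the symmetric functional equation. -/

section Fubini

/-- Substituting `y * u` in the second factor, the quasi-characters of `y` cancel against the
Jacobian. What remains is the Mellin transform of a multiplicative correlation. -/
lemma mellinChar_mul_mellinChar (χ : Kˣ →ₜ* Circle) (s : ℂ) {p q : K → ℂ}
    (hpm : AEStronglyMeasurable p μ)
    (hp : Integrable (fun y => p y * homogeneous χ s y) μ) (hqm : Measurable q)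
    (hq : Integrable (fun y => q y * homogeneous χ⁻¹ (1 - s) y) μ) :
    mellinChar μ χ p s * mellinChar μ χ⁻¹ q (1 - s) =
      ∫ u, homogeneous χ⁻¹ (1 - s) u * ∫ y, p y * q (y * u) ∂μ ∂μ := by
  have hH : ∀ y : K, y ≠ 0 → homogeneous χ⁻¹ (1 - s) y ≠ 0 := fun y hy => by
    rw [← norm_ne_zero_iff, norm_homogeneous _ _ hy]
    exact (Real.rpow_pos_of_pos (modulus_pos hy) _).ne'
  have hHH : ∀ y : K, y ≠ 0 → homogeneous χ s y =
      ((modulus y)⁻¹ : ℝ) * (homogeneous χ⁻¹ (1 - s) y)⁻¹ := fun y hy => by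
    rw [← homogeneous_mul_homogeneous_inv_char χ s hy, mul_inv_cancel_right₀ (hH y hy)]
  let G : K → K → ℂ := fun y u => p y * q (y * u) * homogeneous χ⁻¹ (1 - s) u
  have hG : ∀ y : K, y ≠ 0 → G y = fun u => p y * (homogeneous χ⁻¹ (1 - s) y)⁻¹ *
      (q (y * u) * homogeneous χ⁻¹ (1 - s) (y * u)) := fun y hy => by
    ext u
    simp only [G]
    rw [homogeneous_mul]
    field_simp [hH y hy]
  have hint : Integrable (Function.uncurry G) (μ.prod μ) := by
    have hmeas : AEStronglyMeasurable (Function.uncurry G) (μ.prod μ) := by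
      refine (hpm.comp_fst.mul (hqm.comp measurable_mul).aestronglyMeasurable).mul
        ((measurable_homogeneous _ _).comp measurable_snd).aestronglyMeasurable
    rw [integrable_prod_iff hmeas]
    constructor
    · filter_upwards [ae_ne_zero] with y hy
      change Integrable (G y) μ
      rw [hG y hy]
      exact ((integrable_comp_mul μ (f := fun x => q x * homogeneous χ⁻¹ (1 - s) x) hy).2
        hq).const_mul _
    · refine (hp.norm.mul_const (∫ x, ‖q x * homogeneous χ⁻¹ (1 - s) x‖ ∂μ)).congr ?_
      filter_upwards [ae_ne_zero] with y hy
      change _ = ∫ u, ‖G y u‖ ∂μ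
      rw [hG y hy]
      simp_rw [norm_mul (p y * (homogeneous χ⁻¹ (1 - s) y)⁻¹)]
      rw [integral_const_mul,
        integral_comp_mul μ (fun x => ‖q x * homogeneous χ⁻¹ (1 - s) x‖) hy, hHH y hy,
        norm_mul, norm_mul, norm_mul, Complex.norm_real,
        Real.norm_of_nonneg (inv_nonneg.2 (modulus_nonneg y)), smul_eq_mul]
      ring
  calc mellinChar μ χ p s * mellinChar μ χ⁻¹ q (1 - s)
      = ∫ y, p y * homogeneous χ s y * mellinChar μ χ⁻¹ q (1 - s) ∂μ := by
        rw [integral_mul_const]; rfl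
    _ = ∫ y, ∫ u, G y u ∂μ ∂μ := by
        refine integral_congr_ae ?_
        filter_upwards [ae_ne_zero] with y hy
        rw [hG y hy, integral_const_mul,
          integral_comp_mul μ (fun x => q x * homogeneous χ⁻¹ (1 - s) x) hy, hHH y hy,
          Complex.real_smul, mellinChar]
        ring
    _ = ∫ u, ∫ y, G y u ∂μ ∂μ := integral_integral_swap hint
    _ = _ := by
        refine integral_congr_ae (Eventually.of_forall fun u => ?_)
        simp only [G]
        rw [integral_mul_const, mul_comm]

lemma fourierIntegral_comp_mul (e : AddChar K Circle) (h : K → ℂ) {a : K} (ha : a ≠ 0) (x : K) :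
    Fourier.fourierIntegral e μ (fun w => h (a * w)) x =
      ((modulus a)⁻¹ : ℝ) * Fourier.fourierIntegral e μ h (x / a) := by
  rw [Fourier.fourierIntegral_def, Fourier.fourierIntegral_def, ← Complex.real_smul,
    ← integral_comp_mul μ (fun v => e (-(v * (x / a))) • h v) ha]
  refine integral_congr_ae (Eventually.of_forall fun v => ?_)
  simp only
  congr 3
  field_simp

lemma continuous_fourierIntegral {e : AddChar K Circle} (he : Continuous e) {f : K → ℂ}
    (hf : Integrable f μ) : Continuous (Fourier.fourierIntegral e μ f) :=
  VectorFourier.fourierIntegral_continuous he (by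
    simp only [LinearMap.mul_apply']; fun_prop) hf

lemma fourierIntegral_sub {e : AddChar K Circle} (he : Continuous e) {f g : K → ℂ}
    (hf : Integrable f μ) (hg : Integrable g μ) (x : K) :
    Fourier.fourierIntegral e μ (fun y => f y - g y) x =
      Fourier.fourierIntegral e μ f x - Fourier.fourierIntegral e μ g x := by
  have hL : Continuous fun p : K × K => LinearMap.mul K K p.1 p.2 := by
    simp only [LinearMap.mul_apply']; fun_prop
  have h1 := (VectorFourier.fourierIntegral_convergent_iff he hL x).2 hf
  have h2 := (VectorFourier.fourierIntegral_convergent_iff he hL x).2 hg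
  simp only [Fourier.fourierIntegral_def, smul_sub]
  exact integral_sub h1 h2

lemma fourierIntegral_const_mul (e : AddChar K Circle) (f : K → ℂ) (c : ℂ) (x : K) :
    Fourier.fourierIntegral e μ (fun y => c * f y) x = c * Fourier.fourierIntegral e μ f x :=
  congrFun (Fourier.fourierIntegral_const_smul e μ f c) x

lemma integral_fourierIntegral_mul {e : AddChar K Circle} (he : Continuous e) {f g : K → ℂ}
    (hf : Integrable f μ) (hg : Integrable g μ) :
    ∫ x, Fourier.fourierIntegral e μ f x * g x ∂μ = ∫ x, f x * Fourier.fourierIntegral e μ g x ∂μ := by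
  have h := VectorFourier.integral_fourierIntegral_smul_eq_flip (L := LinearMap.mul K K)
    he (by simp only [LinearMap.mul_apply']; fun_prop) hf hg
  rw [LinearMap.flip_mul] at h
  exact h

variable [hK : Fact (IsUltrametricDist K ∨ Nonempty (NormedAlgebra ℝ K))]

/-- Parseval, with the transform moved onto a dilate of the transform of `g` and undone there by
inversion. Only integrability of `φ` is required, because `φ` will be `log |x|` times a Fourier
transform, which need not be Schwartz–Bruhat. -/
lemma integral_mul_comp_mul {e : AddChar K Circle} (he : Continuous e) (he' : e ≠ 1)
    (hμ : IsSelfDual e μ) {g φ : K → ℂ} (hg : IsSchwartzBruhat g) (hφ : Integrable φ μ)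
    {u : K} (hu : u ≠ 0) :
    ∫ y, g y * φ (y * u) ∂μ =
      ∫ z, Fourier.fourierIntegral e μ φ (-z) * Fourier.fourierIntegral e μ g (z * u) ∂μ := by
  have hg' := hg.fourier μ he he'
  have hu' : -u ≠ 0 := neg_ne_zero.2 hu
  have hint : Integrable (fun w => Fourier.fourierIntegral e μ g (-u * w)) μ :=
    (integrable_comp_mul μ hu').2 hg'.integrable
  symm
  calc ∫ z, Fourier.fourierIntegral e μ φ (-z) * Fourier.fourierIntegral e μ g (z * u) ∂μ
      = ∫ z, Fourier.fourierIntegral e μ φ z * Fourier.fourierIntegral e μ g (-u * z) ∂μ := by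
        rw [← integral_neg_eq_self]
        refine integral_congr_ae (Eventually.of_forall fun z => ?_)
        simp only [neg_neg]
        congr 2
        ring
    _ = ∫ z, φ z * Fourier.fourierIntegral e μ (fun w => Fourier.fourierIntegral e μ g (-u * w)) z ∂μ :=
        integral_fourierIntegral_mul he hφ hint
    _ = ∫ z, ((modulus u)⁻¹ : ℝ) • (g (u⁻¹ * z) * φ z) ∂μ := by
        refine integral_congr_ae (Eventually.of_forall fun z => ?_)
        simp only
        rw [fourierIntegral_comp_mul e _ hu', hμ g hg, modulus_neg, Complex.real_smul]
        have : -(z / -u) = u⁻¹ * z := by field_simp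
        rw [this]
        ring
    _ = ∫ y, g y * φ (y * u) ∂μ := by
        rw [integral_smul, ← integral_comp_mul μ (fun z => g (u⁻¹ * z) * φ z) hu]
        refine integral_congr_ae (Eventually.of_forall fun y => ?_)
        simp only
        rw [inv_mul_cancel_left₀ hu, mul_comm u y]

/-- The functional equation in symmetric form. -/
lemma mellinChar_fourier_symm {e : AddChar K Circle} (he : Continuous e) (he' : e ≠ 1)
    (hμ : IsSelfDual e μ) (χ : Kˣ →ₜ* Circle) {s : ℂ} (hs : 0 < s.re) (hs' : s.re < 1)
    {g φ : K → ℂ} (hg : IsSchwartzBruhat g) (hφm : Measurable φ) (hφ : Integrable φ μ)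
    (hφ' : Integrable (fun y => φ y * homogeneous χ⁻¹ (1 - s) y) μ)
    (hψ : Integrable (fun y => Fourier.fourierIntegral e μ φ (-y) * homogeneous χ s y) μ) :
    mellinChar μ χ g s * mellinChar μ χ⁻¹ φ (1 - s) =
      mellinChar μ χ (fun y => Fourier.fourierIntegral e μ φ (-y)) s *
        mellinChar μ χ⁻¹ (Fourier.fourierIntegral e μ g) (1 - s) := by
  have hg' := hg.fourier μ he he'
  have h1 : (0 : ℝ) < (1 - s).re := by simpa using hs'
  have h2 : (1 - s).re < 1 := by simpa using hs
  rw [mellinChar_mul_mellinChar χ s hg.continuous.aestronglyMeasurable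
      ((hg.mellinStrip 0).integrable_mul χ hs hs') hφm hφ',
    mellinChar_mul_mellinChar χ s (p := fun y => Fourier.fourierIntegral e μ φ (-y))
      ((continuous_fourierIntegral he hφ).comp continuous_neg).aestronglyMeasurable hψ
      hg'.continuous.measurable ((hg'.mellinStrip 0).integrable_mul _ h1 h2)]
  refine integral_congr_ae ?_
  filter_upwards [ae_ne_zero] with u hu
  rw [integral_mul_comp_mul he he' hμ hg hφ hu]

lemma IsSelfDual.fourier_fourier_neg {e : AddChar K Circle} (hμ : IsSelfDual e μ) {f : K → ℂ}
    (hf : IsSchwartzBruhat f) (y : K) :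
    Fourier.fourierIntegral e μ (Fourier.fourierIntegral e μ f) (-y) = f y := by
  rw [hμ f hf, neg_neg]

/-- This is `mellinChar_fourier_symm` with `φ` the Fourier transform of `f`. The symmetry in `f` and
`g` makes the quotient defining `Γ` independent of the test function. -/
lemma functional_equation_symm {e : AddChar K Circle} (he : Continuous e) (he' : e ≠ 1)
    (hμ : IsSelfDual e μ) (χ : Kˣ →ₜ* Circle) {s : ℂ} (hs : 0 < s.re) (hs' : s.re < 1)
    {f g : K → ℂ} (hf : IsSchwartzBruhat f) (hg : IsSchwartzBruhat g) :
    mellinChar μ χ g s * mellinChar μ χ⁻¹ (Fourier.fourierIntegral e μ f) (1 - s) =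
      mellinChar μ χ f s * mellinChar μ χ⁻¹ (Fourier.fourierIntegral e μ g) (1 - s) := by
  have hf' := hf.fourier μ he he'
  have h1 : (0 : ℝ) < (1 - s).re := by simpa using hs'
  have h2 : (1 - s).re < 1 := by simpa using hs
  have h := mellinChar_fourier_symm he he' hμ χ hs hs' hg hf'.continuous.measurable hf'.integrable
    ((hf'.mellinStrip 0).integrable_mul _ h1 h2)
  simp only [hμ.fourier_fourier_neg hf] at h
  exact h ((hf.mellinStrip 0).integrable_mul _ hs hs')

end Fubini

end LocalCommutator

end

noncomputable section

namespace LocalCommutator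

open Filter Set
open scoped ENNReal NNReal Pointwise ContDiff

variable {K : Type*} [NontriviallyNormedField K] [ProperSpace K]
variable [MeasurableSpace K] [BorelSpace K] {μ : Measure K} [μ.IsAddHaarMeasure]
variable [hK : Fact (IsUltrametricDist K ∨ Nonempty (NormedAlgebra ℝ K))]

/-! ### The Gamma function: existence, analyticity, absence of zeros. -/

section Gamma

@[simp]
lemma homogeneous_one_right (χ : Kˣ →ₜ* Circle) (s : ℂ) : homogeneous χ s (1 : K) = 1 := by
  rw [homogeneous, charFun_of_ne_zero χ one_ne_zero, Units.mk0_one, map_one, modulus_one]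
  simp

-- Take a bump so close to `1` that the quasi-character has positive real part on its support. The
-- line `Re s = 1` is allowed since the bump vanishes near zero; compact support serves
-- `mellinStrip_opB`.
variable (μ) in
lemma exists_mellinChar_ne_zero (χ : Kˣ →ₜ* Circle) {s : ℂ} (hs : s.re ≤ 1) :
    ∃ f : K → ℂ, IsPuncturedTest f ∧ HasCompactSupport f ∧ mellinChar μ χ f s ≠ 0 := by
  have hcont : ContinuousAt (fun y : K => (homogeneous χ s y).re) 1 :=
    Complex.continuous_re.continuousAt.comp ((continuousOn_homogeneous χ s).continuousAt
      (isOpen_compl_singleton.mem_nhds (by simp)))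
  have hU : {y : K | 0 < (homogeneous χ s y).re} ∈ 𝓝 (1 : K) :=
    hcont.eventually_const_lt (by simp)
  obtain ⟨f, hf, hfc, hf0, hf1, hfU⟩ := exists_bump hU
  obtain ⟨ε, hε, -, hstrip⟩ := exists_wide_strip μ
  refine ⟨_, hf, hfc, fun h0 => ?_⟩
  have hint := (hstrip _ hf.1 hf.at_zero (s.re - 1)).integrable_mul χ (s := s) (by linarith)
    (by linarith)
  have hre : ∫ y, f y * (homogeneous χ s y).re ∂μ = 0 := by
    have h1 := congrArg Complex.re h0
    rw [mellinChar, ← RCLike.re_eq_complex_re, ← integral_re hint] at h1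
    simpa using h1
  have hint' : Integrable (fun y => f y * (homogeneous χ s y).re) μ := by
    simpa using hint.re
  have hnn : 0 ≤ fun y => f y * (homogeneous χ s y).re := fun y => by
    rcases eq_or_ne (f y) 0 with h | h
    · simp [h]
    · exact mul_nonneg (hf0 y) (le_of_lt (hfU y h))
  have hpos := (integral_pos_iff_support_of_nonneg hnn hint').2 ?_
  · exact hpos.ne' hre
  · have hfcont : Continuous f := by
      have := Complex.continuous_re.comp hf.1.continuous
      simpa [Function.comp_def] using this
    refine ((isOpen_ne_fun hfcont (continuous_const (y := (0 : ℝ)))).measure_pos μ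
      ⟨1, by simp [hf1]⟩).trans_le
      (measure_mono fun y hy => ?_)
    exact mul_ne_zero hy (ne_of_gt (hfU y hy))

variable {e : AddChar K Circle} (χ : Kˣ →ₜ* Circle) {s : ℂ}

lemma one_sub_re_mem {s : ℂ} (hs : 0 < s.re) (hs' : s.re < 1) :
    0 < (1 - s).re ∧ (1 - s).re < 1 := by simp [hs, hs']

lemma isTateGamma_iff (he : Continuous e) (he' : e ≠ 1) (hs : 0 < s.re) (hs' : s.re < 1) {γ : ℂ} :
    IsTateGamma e μ χ s γ ↔ ∀ f : K → ℂ, IsSchwartzBruhat f →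
      mellinChar μ χ⁻¹ (Fourier.fourierIntegral e μ f) (1 - s) = γ * mellinChar μ χ f s := by
  simp only [IsTateGamma, ← homogeneous_inv_char]
  refine forall₂_congr fun f hf => ⟨fun h => h.2.2, fun h => ⟨?_, ?_, h⟩⟩
  · exact ((hf.fourier μ he he').mellinStrip 0).integrable_mul _ (one_sub_re_mem hs hs').1
      (one_sub_re_mem hs hs').2
  · exact (hf.mellinStrip 0).integrable_mul _ hs hs'

lemma isTateGamma_iff_eq_div (he : Continuous e) (he' : e ≠ 1) (hμ : IsSelfDual e μ)
    (hs : 0 < s.re) (hs' : s.re < 1) {g : K → ℂ} (hg : IsSchwartzBruhat g)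
    (hg0 : mellinChar μ χ g s ≠ 0) {γ : ℂ} : IsTateGamma e μ χ s γ ↔
      γ = mellinChar μ χ⁻¹ (Fourier.fourierIntegral e μ g) (1 - s) / mellinChar μ χ g s := by
  rw [isTateGamma_iff χ he he' hs hs']
  refine ⟨fun h => by rw [h g hg, mul_div_cancel_right₀ _ hg0], ?_⟩
  rintro rfl f hf
  rw [div_mul_eq_mul_div, eq_div_iff hg0, mul_comm,
    functional_equation_symm he he' hμ χ hs hs' hf hg, mul_comm]

lemma tateGamma_eq_div (he : Continuous e) (he' : e ≠ 1) (hμ : IsSelfDual e μ)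
    (hs : 0 < s.re) (hs' : s.re < 1) {g : K → ℂ} (hg : IsSchwartzBruhat g)
    (hg0 : mellinChar μ χ g s ≠ 0) : tateGamma e μ χ s =
      mellinChar μ χ⁻¹ (Fourier.fourierIntegral e μ g) (1 - s) / mellinChar μ χ g s := by
  have h : ∃ γ, IsTateGamma e μ χ s γ :=
    ⟨_, (isTateGamma_iff_eq_div χ he he' hμ hs hs' hg hg0).2 rfl⟩
  rw [tateGamma, dif_pos h]
  exact (isTateGamma_iff_eq_div χ he he' hμ hs hs' hg hg0).1 h.choose_spec

lemma isTateGamma_iff_eq_tateGamma (he : Continuous e) (he' : e ≠ 1) (hμ : IsSelfDual e μ)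
    (hs : 0 < s.re) (hs' : s.re < 1) (γ : ℂ) :
    IsTateGamma e μ χ s γ ↔ γ = tateGamma e μ χ s := by
  obtain ⟨g, hg, -, hg0⟩ := exists_mellinChar_ne_zero μ χ hs'.le
  rw [isTateGamma_iff_eq_div χ he he' hμ hs hs' hg.1 hg0,
    tateGamma_eq_div χ he he' hμ hs hs' hg.1 hg0]

lemma mellinChar_fourier (he : Continuous e) (he' : e ≠ 1) (hμ : IsSelfDual e μ)
    (hs : 0 < s.re) (hs' : s.re < 1) {f : K → ℂ} (hf : IsSchwartzBruhat f) :
    mellinChar μ χ⁻¹ (Fourier.fourierIntegral e μ f) (1 - s) =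
      tateGamma e μ χ s * mellinChar μ χ f s :=
  (isTateGamma_iff χ he he' hs hs').1
    ((isTateGamma_iff_eq_tateGamma χ he he' hμ hs hs' _).2 rfl) f hf

lemma mellinChar_comp_neg (h : K → ℂ) (s : ℂ) :
    mellinChar μ χ (fun y => h (-y)) s = homogeneous χ s (-1 : K) * mellinChar μ χ h s := by
  rw [mellinChar, ← integral_neg_eq_self, mellinChar, ← integral_const_mul]
  refine integral_congr_ae (Eventually.of_forall fun y => ?_)
  simp only [neg_neg]
  rw [← neg_one_mul y, homogeneous_mul]
  ring

/-- Apply the functional equation to the transform of some `b`: by inversion its left side is, up to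
a nonzero factor, the Mellin transform of `b` at `1 - s`, which can be chosen nonzero. -/
lemma tateGamma_ne_zero (he : Continuous e) (he' : e ≠ 1) (hμ : IsSelfDual e μ)
    (hs : 0 < s.re) (hs' : s.re < 1) : tateGamma e μ χ s ≠ 0 := by
  intro h0
  obtain ⟨b, hb, -, hb0⟩ := exists_mellinChar_ne_zero μ χ⁻¹ (one_sub_re_mem hs hs').2.le
  have h := mellinChar_fourier χ he he' hμ hs hs' (hb.1.fourier μ he he')
  have h2 : Fourier.fourierIntegral e μ (Fourier.fourierIntegral e μ b) = fun y => b (-y) :=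
    funext (hμ b hb.1)
  rw [h0, zero_mul, h2, mellinChar_comp_neg] at h
  refine mul_ne_zero ?_ hb0 h
  rw [← norm_ne_zero_iff, norm_homogeneous _ _ (by simp)]
  exact (Real.rpow_pos_of_pos (modulus_pos (by simp)) _).ne'

lemma isOpen_strip : IsOpen {s : ℂ | 0 < s.re ∧ s.re < 1} :=
  (isOpen_lt continuous_const Complex.continuous_re).inter
    (isOpen_lt Complex.continuous_re continuous_const)

lemma hasDerivAt_mellinChar_one_sub {h : K → ℂ} {a b : ℝ} (H : MellinStrip μ h a b)
    {s : ℂ} (hs : a < (1 - s).re) (hs' : (1 - s).re < b) :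
    HasDerivAt (fun z => mellinChar μ χ h (1 - z)) (mellinChar μ χ (opA h) (1 - s)) s := by
  have := (H.hasDerivAt χ hs hs').scomp s ((hasDerivAt_id s).const_sub 1)
  simpa [Function.comp_def] using this

/-- A test function whose Mellin transform is nonzero at `s` represents `Γ` as a quotient of
differentiable functions throughout a neighbourhood of `s`. -/
lemma differentiableOn_tateGamma (he : Continuous e) (he' : e ≠ 1) (hμ : IsSelfDual e μ) :
    DifferentiableOn ℂ (tateGamma e μ χ) {s | 0 < s.re ∧ s.re < 1} := by
  rintro s ⟨hs, hs'⟩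
  obtain ⟨g, hg, -, hg0⟩ := exists_mellinChar_ne_zero μ χ hs'.le
  have h1 := ((hg.1.mellinStrip (μ := μ) 0).hasDerivAt χ hs hs').differentiableAt
  have h2 := (hasDerivAt_mellinChar_one_sub χ⁻¹ ((hg.1.fourier μ he he').mellinStrip (μ := μ) 0)
    (one_sub_re_mem hs hs').1 (one_sub_re_mem hs hs').2).differentiableAt
  refine (DifferentiableAt.congr_of_eventuallyEq (h2.div h1 hg0) ?_).differentiableWithinAt
  filter_upwards [isOpen_strip.mem_nhds ⟨hs, hs'⟩, h1.continuousAt.eventually_ne hg0] with z hz hz0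
  exact tateGamma_eq_div χ he he' hμ hz.1 hz.2 hg.1 hz0

end Gamma

end LocalCommutator

end

noncomputable section

namespace LocalCommutator

open Filter Set
open scoped ENNReal NNReal Pointwise ContDiff

variable {K : Type*} [NontriviallyNormedField K] [ProperSpace K]
variable [MeasurableSpace K] [BorelSpace K] {μ : Measure K} [μ.IsAddHaarMeasure]

/-! ### The Fourier transform of the logarithm and the kernel of `K_N`. -/

section LogFourier

variable [hK : Fact (IsUltrametricDist K ∨ Nonempty (NormedAlgebra ℝ K))]
variable {e : AddChar K Circle}

lemma homogeneous_trivial_one {y : K} (hy : y ≠ 0) :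
    homogeneous (1 : Kˣ →ₜ* Circle) 1 y = ((modulus y)⁻¹ : ℝ) := by
  rw [homogeneous, charFun_of_ne_zero _ hy, Complex.cpow_neg_one]
  simp

lemma homogeneous_trivial_zero {y : K} (hy : y ≠ 0) :
    homogeneous (1 : Kˣ →ₜ* Circle) 0 y = 1 := by
  rw [homogeneous, charFun_of_ne_zero _ hy]
  simp

lemma mellinChar_trivial_one (f : K → ℂ) :
    mellinChar μ 1 f 1 = ∫ y, f y * ((modulus y)⁻¹ : ℝ) ∂μ := by
  refine integral_congr_ae ?_
  filter_upwards [ae_ne_zero] with y hy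
  rw [homogeneous_trivial_one hy]

lemma mellinChar_trivial_zero (f : K → ℂ) : mellinChar μ 1 f 0 = ∫ y, f y ∂μ := by
  refine integral_congr_ae ?_
  filter_upwards [ae_ne_zero] with y hy
  rw [homogeneous_trivial_zero hy, mul_one]

lemma IsSelfDual.integral_fourier (hμ : IsSelfDual e μ) {f : K → ℂ} (hf : IsSchwartzBruhat f) :
    ∫ x, Fourier.fourierIntegral e μ f x ∂μ = f 0 := by
  have h := hμ f hf 0
  rw [Fourier.fourierIntegral_def] at h
  simpa using h

/-- Away from the origin, the Fourier transform of `log |x|` is a multiple of `1 / |y|`. -/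
lemma exists_integral_log_fourier (he : Continuous e) (he' : e ≠ 1) (hμ : IsSelfDual e μ) :
    ∃ c : ℂ, ∀ f : K → ℂ, IsSchwartzBruhat f → f 0 = 0 →
      ∫ x, opA (Fourier.fourierIntegral e μ f) x ∂μ = c * ∫ y, f y * ((modulus y)⁻¹ : ℝ) ∂μ := by
  obtain ⟨ε, hε, -, hstrip⟩ := exists_wide_strip μ
  obtain ⟨g, hg, -, hg0⟩ := exists_mellinChar_ne_zero μ (1 : Kˣ →ₜ* Circle) (s := 1) (by simp)
  refine ⟨(∫ x, opA (Fourier.fourierIntegral e μ g) x ∂μ) / mellinChar μ 1 g 1, fun f hf hf0 => ?_⟩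
  rw [← mellinChar_trivial_one, div_mul_eq_mul_div, eq_div_iff hg0]
  have hd : ∀ h : K → ℂ, IsSchwartzBruhat h → h 0 = 0 →
      DifferentiableAt ℂ (mellinChar μ (1 : Kˣ →ₜ* Circle) h) 1 := fun h hh h0 =>
    ((hstrip h hh h0 0).hasDerivAt 1 (by simp) (by simpa using hε)).differentiableAt
  have hd' : ∀ h : K → ℂ, IsSchwartzBruhat h → h 0 = 0 →
      HasDerivAt (fun z => mellinChar μ (1 : Kˣ →ₜ* Circle) (Fourier.fourierIntegral e μ h) (1 - z))
        (∫ x, opA (Fourier.fourierIntegral e μ h) x ∂μ) 1 := fun h hh h0 => by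
    have := hasDerivAt_mellinChar_one_sub (1 : Kˣ →ₜ* Circle) (s := 1)
      ((hh.fourier μ he he').mellinStrip (μ := μ) (-1)) (by simp) (by simp)
    rwa [sub_self, mellinChar_trivial_zero] at this
  have hz : ∀ h : K → ℂ, IsSchwartzBruhat h → h 0 = 0 →
      mellinChar μ (1 : Kˣ →ₜ* Circle) (Fourier.fourierIntegral e μ h) (1 - 1) = 0 :=
    fun h hh h0 => by rw [sub_self, mellinChar_trivial_zero, hμ.integral_fourier hh, h0]
  have D := ((hd g hg.1 hg.at_zero).hasDerivAt.mul (hd' f hf hf0)).sub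
    ((hd f hf hf0).hasDerivAt.mul (hd' g hg.1 hg.at_zero))
  -- At `z = 1` the dual Mellin transforms equal `f 0 = 0` and `g 0 = 0`, so the product rule keeps
  -- only the terms in which they are differentiated.
  simp only [hz f hf hf0, hz g hg.1 hg.at_zero, mul_zero, zero_add] at D
  set D' := mellinChar μ 1 g 1 * ∫ x, opA (Fourier.fourierIntegral e μ f) x ∂μ -
    mellinChar μ 1 f 1 * ∫ x, opA (Fourier.fourierIntegral e μ g) x ∂μ with hD'
  have hzero : D' = 0 := by
    -- The functional equation is available only inside the strip, so the derivative is shown to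
    -- vanish from the left along the real axis.
    have hreal := (D.comp_ofReal (z := 1)).hasDerivWithinAt (s := Ioo (0 : ℝ) 1)
    have hconst : HasDerivWithinAt (fun _ : ℝ => (0 : ℂ)) 0 (Ioo (0 : ℝ) 1) 1 :=
      hasDerivWithinAt_const _ _ _
    have huniq : UniqueDiffWithinAt ℝ (Ioo (0 : ℝ) 1) 1 := by
      refine uniqueDiffWithinAt_convex (convex_Ioo 0 1) (by simp) ?_
      rw [closure_Ioo zero_ne_one]
      simp
    refine huniq.eq_deriv _ hreal (hconst.congr ?_ ?_)
    · intro t ht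
      have h := functional_equation_symm he he' hμ (1 : Kˣ →ₜ* Circle) (s := (t : ℂ))
        (by simpa using ht.1) (by simpa using ht.2) hf hg.1
      rw [inv_one] at h
      simp only [Pi.sub_apply, Pi.mul_apply]
      rw [h, sub_self]
    · simp only [Pi.sub_apply, Pi.mul_apply, Complex.ofReal_one, hz f hf hf0,
        hz g hg.1 hg.at_zero, mul_zero, sub_zero]
  rw [hD', sub_eq_zero] at hzero
  rw [mul_comm, hzero, mul_comm]

lemma opA_sub (f g : K → ℂ) (x : K) : opA (fun y => f y - g y) x = opA f x - opA g x := by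
  simp only [opA]; ring

lemma opA_const_mul (f : K → ℂ) (c : ℂ) (x : K) : opA (fun y => c * f y) x = c * opA f x := by
  simp only [opA]; ring

lemma measurable_opA {f : K → ℂ} (hf : Measurable f) : Measurable (opA f) :=
  (Complex.measurable_ofReal.comp
    (Real.measurable_log.comp continuous_modulus.measurable)).mul hf

lemma IsSchwartzBruhat.integrable_opA {f : K → ℂ} (hf : IsSchwartzBruhat f) :
    Integrable (LocalCommutator.opA f) μ := by
  have h := (hf.mellinStrip (μ := μ) (-1)).opA.2 0 (by norm_num) (by norm_num)
  simp only [neg_zero, Real.rpow_zero, one_mul] at h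
  exact (integrable_norm_iff (measurable_opA hf.continuous.measurable).aestronglyMeasurable).1 h

lemma opB_sub (he : Continuous e) (he' : e ≠ 1) {f g : K → ℂ} (hf : IsSchwartzBruhat f)
    (hg : IsSchwartzBruhat g) (y : K) :
    opB e μ (fun z => f z - g z) y = opB e μ f y - opB e μ g y := by
  rw [opB, opB, opB, ← fourierIntegral_sub he (hf.fourier μ he he').integrable_opA
    (hg.fourier μ he he').integrable_opA]
  congr 1
  ext x
  rw [← opA_sub]
  simp only [opA, fourierIntegral_sub he hf.integrable hg.integrable]

lemma opB_const_mul (f : K → ℂ) (c : ℂ) (y : K) :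
    opB e μ (fun z => c * f z) y = c * opB e μ f y := by
  rw [opB, opB, ← fourierIntegral_const_mul]
  congr 1
  ext x
  rw [← opA_const_mul]
  simp only [opA, fourierIntegral_const_mul]

/-- The factor `e (x y)` is absorbed by translating `f`, so `B f` at `y` tests the transform of `log
|x|` against that translate. -/
lemma opB_eq_integral (f : K → ℂ) (y : K) : opB e μ f y =
    ∫ x, opA (Fourier.fourierIntegral e μ (fun z => f (z + y))) x ∂μ := by
  rw [opB, Fourier.fourierIntegral_def]
  refine integral_congr_ae (Eventually.of_forall fun x => ?_)
  have h := congrFun (Fourier.fourierIntegral_comp_add_right e μ f y) x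
  simp only [Function.comp_def] at h
  simp only [opA]
  rw [h, mul_neg, neg_neg, mul_comm x y]
  simp only [Circle.smul_def, smul_eq_mul]
  ring

/-- The factor by which `[A, ·]` multiplies the kernel at `(y, z)`. -/
def twist (y : K) (N : ℕ) (f : K → ℂ) (z : K) : ℂ :=
  ((Real.log (modulus y) - Real.log (modulus z) : ℝ) : ℂ) ^ N * f z

lemma twist_zero (y : K) (f : K → ℂ) : twist y 0 f = f := by
  ext z
  simp [twist]

lemma twist_succ (y : K) (N : ℕ) (f : K → ℂ) : twist y (N + 1) f =
    fun z => (Real.log (modulus y) : ℂ) * twist y N f z - twist y N (opA f) z := by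
  ext z
  simp only [twist, opA]
  push_cast
  ring

lemma IsPuncturedTest.twist {f : K → ℂ} (hf : IsPuncturedTest f) (y : K) (N : ℕ) :
    IsPuncturedTest (twist y N f) := by
  induction N generalizing f with
  | zero => rwa [twist_zero]
  | succ N ih =>
    rw [twist_succ]
    exact ((ih hf).const_mul _).sub (ih hf.opA)

/-- With `y` frozen, the twist obeys the same recursion in `N` as the commutators. For `N ≥ 1` the
twisted function vanishes at `y`, which removes the `A` term and makes `opB_eq_kernel` applicable.
-/
lemma commutator_eq_conductor_twist (he : Continuous e) (he' : e ≠ 1) (N : ℕ) {f : K → ℂ}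
    (hf : IsPuncturedTest f) (y : K) :
    commutator e μ N f y = conductor e μ (twist y N f) y := by
  induction N generalizing f with
  | zero => rw [commutator, twist_zero]
  | succ N ih =>
    change LocalCommutator.opA (commutator e μ N f) y -
      commutator e μ N (LocalCommutator.opA f) y = _
    rw [ih hf.opA, LocalCommutator.opA, ih hf, twist_succ, conductor, conductor, conductor, opA_sub,
      opB_sub he he' ((hf.twist y N).const_mul _).1 (hf.opA.twist y N).1, opA_const_mul,
      opB_const_mul]
    ring

variable (μ) in
/-- The constant `c` for which `c / |y|` is the inverse Fourier transform of `log |x|` away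
from the origin. -/
structure IsLogConstant (e : AddChar K Circle) (c : ℂ) : Prop where
  integral_log_fourier : ∀ f : K → ℂ, IsSchwartzBruhat f → f 0 = 0 →
    ∫ x, opA (Fourier.fourierIntegral e μ f) x ∂μ = c * ∫ y, f y * ((modulus y)⁻¹ : ℝ) ∂μ

lemma opB_eq_kernel {c : ℂ} (hc : IsLogConstant μ e c) {f : K → ℂ} (hf : IsSchwartzBruhat f)
    {y : K} (hy : f y = 0) :
    opB e μ f y = c * ∫ z, f z * ((modulus (z - y))⁻¹ : ℝ) ∂μ := by
  rw [opB_eq_integral, hc.integral_log_fourier _ (hf.comp_add_right y) (by simpa using hy)]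
  congr 1
  rw [← integral_sub_right_eq_self (fun z => f (z + y) * _) y]
  simp

/-- The kernel `(log |y| - log |z|)^N / |z - y|`. -/
def logKernel (N : ℕ) (y z : K) : ℝ :=
  (Real.log (modulus y) - Real.log (modulus z)) ^ N * (modulus (z - y))⁻¹

lemma commutator_eq_kernel (he : Continuous e) (he' : e ≠ 1) {c : ℂ} (hc : IsLogConstant μ e c)
    {N : ℕ} (hN : 1 ≤ N) {f : K → ℂ} (hf : IsPuncturedTest f) (y : K) :
    commutator e μ N f y = c * ∫ z, (logKernel N y z : ℂ) * f z ∂μ := by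
  have h0 : twist y N f y = 0 := by
    simp [twist, show N ≠ 0 by omega]
  rw [commutator_eq_conductor_twist he he' N hf, conductor, opA, h0, mul_zero, zero_add,
    opB_eq_kernel hc (hf.twist y N).1 h0]
  congr 1
  refine integral_congr_ae (Eventually.of_forall fun z => ?_)
  simp only [twist, logKernel]
  push_cast
  ring

end LogFourier

end LocalCommutator

end

noncomputable section

namespace LocalCommutator

open Filter Set
open scoped ENNReal NNReal Pointwise ContDiff

variable {K : Type*} [NontriviallyNormedField K] [ProperSpace K]
variable [MeasurableSpace K] [BorelSpace K] {μ : Measure K} [μ.IsAddHaarMeasure]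

/-! ### The kernel on the multiplicative group and its Mellin transform. -/

section Kernel

/-- The kernel of the `N`-th commutator as a function on the multiplicative group. -/
def mulKernel (N : ℕ) (u : K) : ℂ :=
  ((Real.log (modulus u) ^ N * (modulus (1 - u))⁻¹ : ℝ) : ℂ)

lemma opA_mulKernel (N : ℕ) : opA (mulKernel (K := K) N) = mulKernel (N + 1) := by
  ext u
  simp only [opA, mulKernel]
  push_cast
  ring

lemma measurable_log_modulus : Measurable fun y : K => Real.log (modulus y) :=
  Real.measurable_log.comp continuous_modulus.measurable

lemma measurable_mulKernel (N : ℕ) : Measurable (mulKernel (K := K) N) :=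
  Complex.measurable_ofReal.comp ((measurable_log_modulus.pow_const _).mul
    (continuous_modulus.measurable.comp (measurable_const.sub measurable_id)).inv)

lemma abs_log_norm_le {u : K} (hu : ‖1 - u‖ < 1 / 2) : |Real.log ‖u‖| ≤ 2 * ‖1 - u‖ := by
  have h1 : ‖u‖ ≤ 1 + ‖1 - u‖ := by
    calc ‖u‖ = ‖1 - (1 - u)‖ := by rw [sub_sub_cancel]
      _ ≤ ‖(1 : K)‖ + ‖1 - u‖ := norm_sub_le _ _
      _ = _ := by rw [norm_one]
  have h2 : 1 ≤ ‖1 - u‖ + ‖u‖ := by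
    calc 1 = ‖(1 - u) + u‖ := by rw [sub_add_cancel, norm_one]
      _ ≤ _ := norm_add_le _ _
  have ht : 1 / 2 < ‖u‖ := by linarith
  have ht0 : 0 < ‖u‖ := by linarith
  rw [abs_le]
  constructor
  · have h3 := Real.log_le_sub_one_of_pos (inv_pos.2 ht0)
    rw [Real.log_inv] at h3
    have h4 : ‖u‖⁻¹ - 1 ≤ 2 * ‖1 - u‖ := by
      rw [sub_le_iff_le_add, inv_le_iff_one_le_mul₀ ht0]
      nlinarith [norm_nonneg (1 - u)]
    linarith
  · have h3 := Real.log_le_sub_one_of_pos ht0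
    have := norm_nonneg (1 - u)
    linarith

/-- Away from `u = 1`, `1 / |1 - u|` is bounded and is `O(1 / |u|)`, which gives the strip `(0, 1)`;
the logarithm is then free by `MellinStrip.opA`. Near `u = 1` one has `|log |u|| = O(|1 -
u|^(1/d))`, which makes the singularity integrable. -/
lemma mellinStrip_mulKernel_one : MellinStrip μ (mulKernel (K := K) 1) 0 1 := by
  obtain ⟨d, hd, hn⟩ := exists_modulus_eq_norm_rpow K
  let S : Set K := {u | ‖1 - u‖ < 1 / 2}
  have hS : MeasurableSet S :=
    measurableSet_lt (by fun_prop) measurable_const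
  let v : K → ℂ := Sᶜ.indicator fun u => (((modulus (1 - u))⁻¹ : ℝ) : ℂ)
  have hinv : Measurable fun u : K => (((modulus (1 - u))⁻¹ : ℝ) : ℂ) :=
    Complex.measurable_ofReal.comp
      (continuous_modulus.measurable.comp (measurable_const.sub measurable_id)).inv
  have hvm : Measurable v := hinv.indicator hS.compl
  have hvS : ∀ u, u ∉ S → ‖v u‖ = (modulus (1 - u))⁻¹ := fun u hu => by
    simp only [v]
    rw [indicator_of_mem (show u ∈ Sᶜ from hu), Complex.norm_real,
      Real.norm_of_nonneg (inv_nonneg.2 (modulus_nonneg _))]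
  have hv0 : ∀ u, u ∈ S → v u = 0 := fun u hu => indicator_of_notMem (fun h : u ∈ Sᶜ => h hu) _
  have hv : MellinStrip μ v 0 1 := by
    -- Outside `S`, `‖1 - u‖⁻¹ ≤ 2` and `‖u‖ ≤ 3 * ‖1 - u‖`; the constant collects the `d`-th
    -- powers.
    have := MellinStrip.of_bounds (μ := μ) (h := v) (α := 0) (β := 1) (C := 2 ^ d + 3 ^ d)
      hvm.aestronglyMeasurable (fun u hu => ?_) (fun u hu => ?_)
    · simpa using this
    · rw [neg_zero, Real.rpow_zero, mul_one]
      by_cases h : u ∈ S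
      · rw [hv0 u h, norm_zero]; positivity
      · rw [hvS u h, hn, ← Real.inv_rpow (norm_nonneg _)]
        have h1 : 1 / 2 ≤ ‖1 - u‖ := not_lt.1 h
        have h2 : ‖1 - u‖⁻¹ ≤ 2 := by
          rw [inv_le_comm₀ (by linarith) (by norm_num)]; linarith
        have := Real.rpow_le_rpow (by positivity) h2 hd.le
        have : (0 : ℝ) ≤ 3 ^ d := by positivity
        linarith
    · have hu' := norm_pos_iff.2 hu
      by_cases h : u ∈ S
      · rw [hv0 u h, norm_zero]
        have := modulus_nonneg u
        positivity
      · have h1 : 1 / 2 ≤ ‖1 - u‖ := not_lt.1 h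
        have h2 : ‖u‖ ≤ 3 * ‖1 - u‖ := by
          have : ‖u‖ ≤ ‖(1 : K)‖ + ‖1 - u‖ := by simpa using norm_sub_le (1 : K) (1 - u)
          rw [norm_one] at this
          linarith
        have h3 : ‖1 - u‖⁻¹ ≤ 3 * ‖u‖⁻¹ := by
          rw [← div_eq_mul_inv, le_div_iff₀ hu', inv_mul_le_iff₀ (by linarith)]
          linarith
        rw [hvS u h, hn, hn, Real.rpow_neg_one, ← Real.inv_rpow (norm_nonneg _),
          ← Real.inv_rpow (norm_nonneg _)]
        have h4 := Real.rpow_le_rpow (by positivity) h3 hd.le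
        rw [Real.mul_rpow (by norm_num) (by positivity)] at h4
        have : 0 ≤ (2 : ℝ) ^ d * ‖u‖⁻¹ ^ d := by positivity
        linarith
  let r : K → ℂ := S.indicator (mulKernel 1)
  have hrm : Measurable r := (measurable_mulKernel 1).indicator hS
  have hr : MellinStrip μ r 0 1 := by
    refine ⟨hrm.aestronglyMeasurable, fun σ hσ hσ' => ?_⟩
    let F : K → ℝ := {x : K | ‖x‖ < 1 / 2}.indicator fun x => modulus x ^ (d⁻¹ - 1)
    have hT : MeasurableSet {x : K | ‖x‖ < 1 / 2} := measurableSet_lt (by fun_prop) measurable_const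
    have hFm : Measurable F := (continuous_modulus.measurable.pow_const _).indicator hT
    have hdi : 0 < d⁻¹ := inv_pos.2 hd
    have hF : Integrable F μ := by
      refine integrable_of_modulus_bounds (a := 1 - d⁻¹) (b := 2) (C := 1) hFm.aestronglyMeasurable
        (by linarith) (by norm_num) (fun x hx => ?_) (fun x hx => ?_)
      all_goals
        have hx' := modulus_pos hx
        rw [one_mul]
        by_cases h : x ∈ {x : K | ‖x‖ < 1 / 2}
        · simp only [F]
          rw [indicator_of_mem h, Real.norm_of_nonneg (by positivity)]
          first
          | exact (by rw [neg_sub])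
          | exact Real.rpow_le_rpow_of_exponent_ge hx'
              (modulus_lt_one (lt_trans h (by norm_num))).le (by linarith)
        · simp only [F]
          rw [indicator_of_notMem h, norm_zero]
          positivity
    refine ((hF.comp_sub_left 1).const_mul ((1 / 2) ^ (-(d * σ)) * (2 * d))).mono
      ((continuous_modulus.measurable.pow_const _).aestronglyMeasurable.mul
        hrm.aestronglyMeasurable.norm) (Eventually.of_forall fun u => ?_)
    have hu0 := modulus_nonneg u
    rw [norm_mul, norm_norm, Real.norm_of_nonneg (by positivity)]
    refine le_trans ?_ (le_abs_self _)
    by_cases h : u ∈ S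
    · have h' : 1 - u ∈ {x : K | ‖x‖ < 1 / 2} := h
      simp only [r, F]
      rw [indicator_of_mem h, indicator_of_mem h', mulKernel, Complex.norm_real, norm_mul, norm_inv,
        Real.norm_of_nonneg (modulus_nonneg (1 - u)), pow_one, Real.norm_eq_abs]
      have hu : 1 / 2 ≤ ‖u‖ := by
        have : ‖(1 : K)‖ ≤ ‖1 - u‖ + ‖u‖ := by simpa using norm_add_le (1 - u) u
        rw [norm_one] at this
        have : ‖1 - u‖ < 1 / 2 := h
        linarith
      have e1 : modulus u ^ (-σ) ≤ (1 / 2) ^ (-(d * σ)) := by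
        rw [hn, ← Real.rpow_mul (norm_nonneg _), mul_neg]
        exact Real.rpow_le_rpow_of_nonpos (by norm_num) hu (neg_nonpos.2 (by positivity))
      rcases eq_or_ne (1 - u) 0 with h1u | h1u
      · have : u = 1 := (sub_eq_zero.1 h1u).symm
        rw [this]
        have h0 := Real.rpow_nonneg (modulus_nonneg (1 - 1 : K)) (d⁻¹ - 1)
        simp only [modulus_one, Real.log_one, abs_zero, zero_mul, mul_zero]
        positivity
      · have e2 : |Real.log (modulus u)| ≤ (2 * d) * modulus (1 - u) ^ d⁻¹ := by
          rw [hn, Real.log_rpow (by linarith), abs_mul, abs_of_pos hd, hn (1 - u),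
            Real.rpow_rpow_inv (norm_nonneg _) hd.ne']
          have := mul_le_mul_of_nonneg_left (abs_log_norm_le h) hd.le
          linarith
        have hp := modulus_pos h1u
        calc modulus u ^ (-σ) * (|Real.log (modulus u)| * (modulus (1 - u))⁻¹)
            ≤ (1 / 2) ^ (-(d * σ)) * (((2 * d) * modulus (1 - u) ^ d⁻¹) * (modulus (1 - u))⁻¹) := by
              gcongr
          _ = _ := by
              rw [sub_eq_add_neg d⁻¹, Real.rpow_add hp, Real.rpow_neg_one]
              ring
    · have h' : 1 - u ∉ {x : K | ‖x‖ < 1 / 2} := h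
      simp only [r, F]
      rw [indicator_of_notMem h, indicator_of_notMem h']
      simp
  have hsum : mulKernel 1 = fun u => opA v u + r u := by
    ext u
    by_cases h : u ∈ S
    · simp only [opA, r]
      rw [hv0 u h, indicator_of_mem h]
      simp
    · simp only [opA, v, r]
      rw [indicator_of_notMem h, indicator_of_mem (show u ∈ Sᶜ from h), mulKernel]
      push_cast
      ring
  rw [hsum]
  exact hv.opA.add hr

lemma mellinStrip_mulKernel {N : ℕ} (hN : 1 ≤ N) : MellinStrip μ (mulKernel (K := K) N) 0 1 := by
  induction N, hN using Nat.le_induction with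
  | base => exact mellinStrip_mulKernel_one
  | succ N hN ih =>
    rw [← opA_mulKernel]
    exact ih.opA

/-- Homogeneity of degree `-1`: up to the Jacobian, the kernel depends only on the ratio of its
arguments. -/
lemma logKernel_mul (N : ℕ) {z u : K} (hz : z ≠ 0) (hu : u ≠ 0) :
    (logKernel N (z * u) z : ℂ) = ((modulus z)⁻¹ : ℝ) * mulKernel N u := by
  rw [mulKernel, logKernel, ← Complex.ofReal_mul]
  congr 1
  rw [modulus_mul, Real.log_mul (modulus_pos hz).ne' (modulus_pos hu).ne', add_sub_cancel_left,
    show z - z * u = z * (1 - u) by ring, modulus_mul, mul_inv]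
  ring

lemma logKernel_swap (N : ℕ) (y z : K) : logKernel N z y = (-1) ^ N * logKernel N y z := by
  rw [logKernel, logKernel, ← neg_sub (Real.log (modulus y)), neg_pow, ← neg_sub z y, modulus_neg]
  ring

lemma measurable_logKernel (N : ℕ) : Measurable fun p : K × K => logKernel N p.1 p.2 :=
  (((measurable_log_modulus.comp measurable_fst).sub
    (measurable_log_modulus.comp measurable_snd)).pow_const _).mul
      (continuous_modulus.measurable.comp (measurable_snd.sub measurable_fst)).inv

variable (χ : Kˣ →ₜ* Circle) {s : ℂ}

/-- The integrand for the pairing of `K_N h` with `χ⁻¹(y) |y|^(-s)`. -/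
def kernelIntegrand (χ : Kˣ →ₜ* Circle) (s : ℂ) (N : ℕ) (h : K → ℂ) (z y : K) : ℂ :=
  logKernel N y z * h z * homogeneous χ s y

lemma kernelIntegrand_mul (N : ℕ) (h : K → ℂ) {z u : K} (hz : z ≠ 0) (hu : u ≠ 0) :
    kernelIntegrand χ s N h z (z * u) = ((modulus z)⁻¹ : ℝ) * (h z * homogeneous χ s z) *
      (mulKernel N u * homogeneous χ s u) := by
  rw [kernelIntegrand, logKernel_mul N hz hu, homogeneous_mul]
  ring

lemma integral_kernelIntegrand (N : ℕ) (h : K → ℂ) {z : K} (hz : z ≠ 0) :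
    ∫ y, kernelIntegrand χ s N h z y ∂μ =
      (h z * homogeneous χ s z) * mellinChar μ χ (mulKernel N) s := by
  have h1 := integral_comp_mul μ (kernelIntegrand χ s N h z) hz
  have h2 : ∫ u, kernelIntegrand χ s N h z (z * u) ∂μ =
      ((modulus z)⁻¹ : ℝ) * (h z * homogeneous χ s z) * mellinChar μ χ (mulKernel N) s := by
    rw [mellinChar, ← integral_const_mul]
    refine integral_congr_ae ?_
    filter_upwards [ae_ne_zero] with u hu
    rw [kernelIntegrand_mul χ N h hz hu]
  rw [h2, Complex.real_smul, mul_assoc] at h1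
  refine (mul_left_cancel₀ ?_ h1).symm
  exact_mod_cast inv_ne_zero (modulus_pos hz).ne'

lemma integrable_kernelIntegrand (hs : 0 < s.re) (hs' : s.re < 1) {N : ℕ} (hN : 1 ≤ N) {h : K → ℂ}
    (hm : AEStronglyMeasurable h μ) (hh : Integrable (fun y => h y * homogeneous χ s y) μ) :
    Integrable (Function.uncurry (kernelIntegrand χ s N h)) (μ.prod μ) := by
  have hw := (mellinStrip_mulKernel (μ := μ) hN).integrable_mul χ hs hs'
  have hmeas : AEStronglyMeasurable (Function.uncurry (kernelIntegrand χ s N h)) (μ.prod μ) := by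
    refine ((Complex.measurable_ofReal.comp ((measurable_logKernel N).comp
      measurable_swap)).aestronglyMeasurable.mul hm.comp_fst).mul
        ((measurable_homogeneous χ s).comp measurable_snd).aestronglyMeasurable
  rw [integrable_prod_iff hmeas]
  constructor
  · filter_upwards [ae_ne_zero] with z hz
    change Integrable (kernelIntegrand χ s N h z) μ
    rw [← integrable_comp_mul μ hz]
    refine (hw.const_mul (((modulus z)⁻¹ : ℝ) * (h z * homogeneous χ s z))).congr ?_
    filter_upwards [ae_ne_zero] with u hu
    rw [kernelIntegrand_mul χ N h hz hu]
  · refine (hh.norm.mul_const (∫ u, ‖mulKernel N u * homogeneous χ s u‖ ∂μ)).congr ?_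
    filter_upwards [ae_ne_zero] with z hz
    change _ = ∫ y, ‖kernelIntegrand χ s N h z y‖ ∂μ
    have h1 := integral_comp_mul μ (fun y => ‖kernelIntegrand χ s N h z y‖) hz
    have h2 : ∫ u, ‖kernelIntegrand χ s N h z (z * u)‖ ∂μ =
        (modulus z)⁻¹ * (‖h z * homogeneous χ s z‖ *
          ∫ u, ‖mulKernel N u * homogeneous χ s u‖ ∂μ) := by
      rw [← integral_const_mul, ← integral_const_mul]
      refine integral_congr_ae ?_
      filter_upwards [ae_ne_zero] with u hu
      rw [kernelIntegrand_mul χ N h hz hu, norm_mul, norm_mul, Complex.norm_real,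
        Real.norm_of_nonneg (inv_nonneg.2 (modulus_nonneg z)), mul_assoc]
    rw [h2, smul_eq_mul] at h1
    exact mul_left_cancel₀ (inv_ne_zero (modulus_pos hz).ne') h1

end Kernel

/-! ### The action on quasi-characters and the transposition rule. -/

section Pairing

variable [hK : Fact (IsUltrametricDist K ∨ Nonempty (NormedAlgebra ℝ K))]
variable {e : AddChar K Circle} (χ : Kˣ →ₜ* Circle) {s : ℂ}

lemma homogeneous_mul_commutator (he : Continuous e) (he' : e ≠ 1) {c : ℂ}
    (hc : IsLogConstant μ e c) {N : ℕ} (hN : 1 ≤ N) {f : K → ℂ} (hf : IsPuncturedTest f) (y : K) :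
    homogeneous χ s y * commutator e μ N f y = c * ∫ z, kernelIntegrand χ s N f z y ∂μ := by
  simp only [kernelIntegrand]
  rw [commutator_eq_kernel he he' hc hN hf, integral_mul_const]
  ring

lemma integrable_homogeneous_mul_commutator (he : Continuous e) (he' : e ≠ 1) {c : ℂ}
    (hc : IsLogConstant μ e c) {N : ℕ} (hN : 1 ≤ N) {f : K → ℂ} (hf : IsPuncturedTest f)
    (hs : 0 < s.re) (hs' : s.re < 1) :
    Integrable (fun y => homogeneous χ s y * commutator e μ N f y) μ := by
  simp only [homogeneous_mul_commutator χ he he' hc hN hf]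
  exact (integrable_kernelIntegrand χ hs hs' hN hf.1.continuous.aestronglyMeasurable
    ((hf.1.mellinStrip 0).integrable_mul χ hs hs')).integral_prod_right.const_mul c

lemma pairing_homogeneous_commutator (he : Continuous e) (he' : e ≠ 1) {c : ℂ}
    (hc : IsLogConstant μ e c) {N : ℕ} (hN : 1 ≤ N) {f : K → ℂ} (hf : IsPuncturedTest f)
    (hs : 0 < s.re) (hs' : s.re < 1) :
    pairing μ (homogeneous χ s) (commutator e μ N f) =
      c * mellinChar μ χ (mulKernel N) s * mellinChar μ χ f s := by
  have hint := integrable_kernelIntegrand χ hs hs' hN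
    (hf.1.continuous.aestronglyMeasurable (μ := μ))
    ((hf.1.mellinStrip 0).integrable_mul χ hs hs')
  rw [pairing]
  simp only [homogeneous_mul_commutator χ he he' hc hN hf]
  rw [integral_const_mul, ← integral_integral_swap hint, mul_assoc, mul_comm (mellinChar _ _ _ _),
    mellinChar, ← integral_mul_const]
  congr 1
  refine integral_congr_ae ?_
  filter_upwards [ae_ne_zero] with z hz
  exact integral_kernelIntegrand χ N f hz

/-- The majorant is the quasi-character at the centre of the strip, so integrability against it
passes to integrability against `f`. -/
lemma IsSchwartzBruhat.norm_le_rpow {f : K → ℂ} (hf : IsSchwartzBruhat f) :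
    ∃ C : ℝ, ∀ y ≠ 0, ‖f y‖ ≤ C * modulus y ^ (-(1 / 2) : ℝ) := by
  obtain ⟨C, hC0, hC⟩ := hf.decay 0
  obtain ⟨C', hC0', hC'⟩ := hf.decay 1
  refine ⟨C + C', fun y hy => ?_⟩
  have hy' := modulus_pos hy
  have h0 := hC y
  have h1 := hC' y
  rw [pow_zero, one_mul] at h0
  rw [pow_one] at h1
  have hh : 0 < modulus y ^ (1 / 2 : ℝ) := by positivity
  rw [Real.rpow_neg hy'.le, ← div_eq_mul_inv, le_div_iff₀ hh]
  rcases le_total (modulus y) 1 with h | h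
  · have := Real.rpow_le_one hy'.le h (by norm_num : (0 : ℝ) ≤ 1 / 2)
    have := mul_le_of_le_one_right (norm_nonneg (f y)) this
    linarith
  · have := Real.rpow_le_rpow_of_exponent_le h (by norm_num : (1 / 2 : ℝ) ≤ 1)
    rw [Real.rpow_one] at this
    have := mul_le_mul_of_nonneg_left this (norm_nonneg (f y))
    linarith

lemma pairing_commutator_transpose (he : Continuous e) (he' : e ≠ 1) {c : ℂ}
    (hc : IsLogConstant μ e c) {N : ℕ} (hN : 1 ≤ N) {f g : K → ℂ} (hf : IsPuncturedTest f)
    (hg : IsPuncturedTest g) :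
    pairing μ (commutator e μ N f) g = (-1) ^ N * pairing μ f (commutator e μ N g) := by
  have h1 : (0 : ℝ) < (1 / 2 : ℂ).re := by norm_num
  have h2 : (1 / 2 : ℂ).re < (1 : ℝ) := by norm_num
  -- The trivial character at `s = 1/2` supplies the absolute convergence that Fubini needs.
  have hint := integrable_kernelIntegrand 1 h1 h2 hN (hf.1.continuous.aestronglyMeasurable (μ := μ))
    ((hf.1.mellinStrip 0).integrable_mul 1 h1 h2)
  have hint' : Integrable (Function.uncurry fun z y => (logKernel N y z : ℂ) * f z * g y)
      (μ.prod μ) := by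
    obtain ⟨C, hC⟩ := hg.1.norm_le_rpow
    refine (hint.const_mul (C : ℂ)).mono ?_ ?_
    · refine ((Complex.measurable_ofReal.comp ((measurable_logKernel N).comp
        measurable_swap)).mul (hf.1.continuous.measurable.comp measurable_fst)).mul
          (hg.1.continuous.measurable.comp measurable_snd) |>.aestronglyMeasurable
    · have hae : ∀ᵐ p : K × K ∂(μ.prod μ), p.2 ≠ 0 :=
        Measure.quasiMeasurePreserving_snd.ae ae_ne_zero
      filter_upwards [hae] with p hp
      have h3 := hC p.2 hp
      simp only [Function.uncurry, kernelIntegrand]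
      rw [norm_mul, norm_mul _ (_ * _), norm_mul (_ * _) (homogeneous _ _ _),
        norm_homogeneous _ _ hp, Complex.norm_real]
      have e1 : (1 / 2 : ℂ).re = 1 / 2 := by norm_num
      rw [e1]
      calc _ ≤ ‖(logKernel N p.2 p.1 : ℂ) * f p.1‖ * (C * modulus p.2 ^ (-(1 / 2) : ℝ)) := by gcongr
        _ = C * (‖(logKernel N p.2 p.1 : ℂ) * f p.1‖ * modulus p.2 ^ (-(1 / 2) : ℝ)) := by ring
        _ ≤ _ := by
          have := modulus_nonneg p.2
          gcongr
          exact le_abs_self C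
  calc pairing μ (commutator e μ N f) g
      = c * ∫ y, ∫ z, (logKernel N y z : ℂ) * f z * g y ∂μ ∂μ := by
        rw [pairing, ← integral_const_mul]
        refine integral_congr_ae (Eventually.of_forall fun y => ?_)
        simp only
        rw [commutator_eq_kernel he he' hc hN hf, integral_mul_const, mul_assoc]
    _ = c * ∫ z, ∫ y, (logKernel N y z : ℂ) * f z * g y ∂μ ∂μ := by
        rw [← integral_integral_swap hint']
    _ = _ := by
        rw [pairing, ← integral_const_mul, ← integral_const_mul]
        refine integral_congr_ae (Eventually.of_forall fun z => ?_)
        simp only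
        rw [commutator_eq_kernel he he' hc hN hg, ← integral_const_mul, ← integral_const_mul,
          ← integral_const_mul, ← integral_const_mul]
        refine integral_congr_ae (Eventually.of_forall fun y => ?_)
        simp only
        rw [logKernel_swap N z y]
        push_cast
        ring

end Pairing

end LocalCommutator

end

noncomputable section

namespace LocalCommutator

open Filter Set
open scoped ENNReal NNReal Pointwise ContDiff

/-! ### Schur's test and integral operators on `L²`. -/

section SchurTest

/-- An integral operator which satisfies an `L²` bound for its absolute value defines a bounded
operator on `L²`. -/
lemma exists_bounded_operator_of_kernel {X : Type*} [MeasurableSpace X] {μ : Measure X} [SFinite μ]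
    {k : X → X → ℂ} (hk : Measurable (Function.uncurry k)) {C : ℝ≥0}
    (H : ∀ f : X → ℂ, StronglyMeasurable f →
      ∫⁻ y, (∫⁻ z, ‖k y z * f z‖ₑ ∂μ) ^ (2 : ℝ) ∂μ ≤ (C : ℝ≥0∞) ^ (2 : ℝ) * ∫⁻ z, ‖f z‖ₑ ^ (2 : ℝ) ∂μ) :
    ∃ T : Lp ℂ 2 μ →L[ℂ] Lp ℂ 2 μ, ∀ (f : X → ℂ) (hf : MemLp f 2 μ),
      ∃ hT : MemLp (fun y => ∫ z, k y z * f z ∂μ) 2 μ, T (hf.toLp f) = hT.toLp _ := by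
  let S : Lp ℂ 2 μ → X → ℂ := fun f y => ∫ z, k y z * f z ∂μ
  have enorm_two : ∀ g : X → ℂ, eLpNorm g 2 μ = (∫⁻ x, ‖g x‖ₑ ^ (2 : ℝ) ∂μ) ^ (1 / 2 : ℝ) := fun g => by
    rw [eLpNorm_eq_lintegral_rpow_enorm_toReal two_ne_zero ENNReal.ofNat_ne_top,
      ENNReal.toReal_ofNat]
  have hmeas : ∀ f : Lp ℂ 2 μ, Measurable (Function.uncurry fun y z => k y z * f z) := fun f =>
    hk.mul ((Lp.stronglyMeasurable f).measurable.comp measurable_snd)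
  have hbound : ∀ f : Lp ℂ 2 μ, eLpNorm (S f) 2 μ ≤ C * eLpNorm f 2 μ := fun f => by
    rw [enorm_two, enorm_two]
    calc (∫⁻ y, ‖S f y‖ₑ ^ (2 : ℝ) ∂μ) ^ (1 / 2 : ℝ)
        ≤ (∫⁻ y, (∫⁻ z, ‖k y z * f z‖ₑ ∂μ) ^ (2 : ℝ) ∂μ) ^ (1 / 2 : ℝ) := by
          gcongr with y
          exact enorm_integral_le_lintegral_enorm _
      _ ≤ ((C : ℝ≥0∞) ^ (2 : ℝ) * ∫⁻ z, ‖f z‖ₑ ^ (2 : ℝ) ∂μ) ^ (1 / 2 : ℝ) := by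
          gcongr
          exact H f (Lp.stronglyMeasurable f)
      _ = _ := by
          rw [ENNReal.mul_rpow_of_nonneg _ _ (by norm_num), ← ENNReal.rpow_mul]
          norm_num
  have hmem : ∀ f : Lp ℂ 2 μ, MemLp (S f) 2 μ := fun f =>
    ⟨(hmeas f).stronglyMeasurable.integral_prod_right.aestronglyMeasurable,
      (hbound f).trans_lt (ENNReal.mul_lt_top ENNReal.coe_lt_top (Lp.memLp f).2)⟩
  -- Additivity of the operator needs almost every inner integral to converge, since a divergent one
  -- is assigned the value zero.
  have hint : ∀ f : Lp ℂ 2 μ, ∀ᵐ y ∂μ, Integrable (fun z => k y z * f z) μ := fun f => by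
    have hm : Measurable fun y => ∫⁻ z, ‖k y z * f z‖ₑ ∂μ := (hmeas f).enorm.lintegral_prod_right'
    have hfin : ∫⁻ y, (∫⁻ z, ‖k y z * f z‖ₑ ∂μ) ^ (2 : ℝ) ∂μ ≠ ⊤ := by
      refine ((H f (Lp.stronglyMeasurable f)).trans_lt (ENNReal.mul_lt_top (by simp) ?_)).ne
      have h := (Lp.memLp f).2
      rw [enorm_two] at h
      by_contra hc
      rw [not_lt, top_le_iff] at hc
      rw [hc] at h
      simp at h
    filter_upwards [ae_lt_top (hm.pow_const _) hfin] with y hy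
    refine ⟨((hmeas f).comp measurable_prodMk_left).aestronglyMeasurable, ?_⟩
    by_contra hc
    rw [hasFiniteIntegral_iff_enorm, not_lt, top_le_iff] at hc
    rw [hc] at hy
    simp at hy
  let T₀ : Lp ℂ 2 μ →ₗ[ℂ] Lp ℂ 2 μ :=
    { toFun := fun f => (hmem f).toLp (S f)
      map_add' := fun f g => by
        rw [← MemLp.toLp_add]
        refine MemLp.toLp_congr _ _ ?_
        filter_upwards [hint f, hint g] with y h1 h2
        rw [Pi.add_apply, ← integral_add h1 h2]
        refine integral_congr_ae ?_
        filter_upwards [Lp.coeFn_add f g] with z hz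
        rw [hz, Pi.add_apply, mul_add]
      map_smul' := fun c f => by
        rw [RingHom.id_apply, ← MemLp.toLp_const_smul]
        refine MemLp.toLp_congr _ _ (Eventually.of_forall fun y => ?_)
        rw [Pi.smul_apply, smul_eq_mul, ← integral_const_mul]
        refine integral_congr_ae ?_
        filter_upwards [Lp.coeFn_smul c f] with z hz
        rw [hz, Pi.smul_apply, smul_eq_mul]
        ring }
  refine ⟨T₀.mkContinuous C fun f => ?_, fun f hf => ?_⟩
  · change ‖(hmem f).toLp (S f)‖ ≤ _
    rw [Lp.norm_toLp, Lp.norm_def]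
    refine ENNReal.toReal_le_of_le_ofReal (by positivity) ((hbound f).trans_eq ?_)
    rw [ENNReal.ofReal_mul C.coe_nonneg, ENNReal.ofReal_toReal (Lp.eLpNorm_ne_top f),
      ENNReal.ofReal_coe_nnreal]
  · have heq : S (hf.toLp f) = fun y => ∫ z, k y z * f z ∂μ := by
      ext y
      refine integral_congr_ae ?_
      filter_upwards [hf.coeFn_toLp] with z hz
      rw [hz]
    refine ⟨heq ▸ hmem (hf.toLp f), ?_⟩
    change (hmem (hf.toLp f)).toLp (S (hf.toLp f)) = _
    congr

/-- Schur's test with a weight `ρ`, for a kernel which is symmetric in absolute value. -/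
lemma schur_test {X : Type*} [MeasurableSpace X] {μ : Measure X} [SFinite μ]
    {k : X → X → ℝ≥0∞} (hk : Measurable (Function.uncurry k)) (hsymm : ∀ y z, k y z = k z y)
    {ρ : X → ℝ≥0∞} (hρ : Measurable ρ) (hρ0 : ∀ᵐ z ∂μ, ρ z ≠ 0) (hρt : ∀ᵐ z ∂μ, ρ z ≠ ⊤) {C : ℝ≥0∞}
    (H : ∀ᵐ y ∂μ, ∫⁻ z, k y z * ρ z ∂μ = C * ρ y) {f : X → ℝ≥0∞} (hf : Measurable f) :
    ∫⁻ y, (∫⁻ z, k y z * f z ∂μ) ^ (2 : ℝ) ∂μ ≤ C ^ (2 : ℝ) * ∫⁻ z, f z ^ (2 : ℝ) ∂μ := by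
  have hky : ∀ y, Measurable (k y) := fun y => hk.comp measurable_prodMk_left
  have hg : Measurable fun z => (ρ z)⁻¹ * f z ^ (2 : ℝ) := hρ.inv.mul (hf.pow_const _)
  have key : ∀ᵐ y ∂μ, (∫⁻ z, k y z * f z ∂μ) ^ (2 : ℝ) ≤
      C * ρ y * ∫⁻ z, k y z * ((ρ z)⁻¹ * f z ^ (2 : ℝ)) ∂μ := by
    filter_upwards [H] with y hy
    rw [← hy]
    have hconj : (2 : ℝ).HolderConjugate 2 := Real.HolderConjugate.two_two
    -- Cauchy–Schwarz for the splitting `k f = (k ρ)^(1/2) (k f² / ρ)^(1/2)`.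
    have h := ENNReal.lintegral_mul_le_Lp_mul_Lq μ hconj
      (f := fun z => (k y z * ρ z) ^ (1 / 2 : ℝ))
      (g := fun z => (k y z * ((ρ z)⁻¹ * f z ^ (2 : ℝ))) ^ (1 / 2 : ℝ))
      (((hky y).mul hρ).pow_const _).aemeasurable
      (((hky y).mul hg).pow_const _).aemeasurable
    have e1 : ∀ x : ℝ≥0∞, (x ^ (1 / 2 : ℝ)) ^ (2 : ℝ) = x := fun x => by
      rw [← ENNReal.rpow_mul]; norm_num
    have e2 : ∀ x : ℝ≥0∞, (x ^ (2 : ℝ)) ^ (1 / 2 : ℝ) = x := fun x => by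
      rw [← ENNReal.rpow_mul]; norm_num
    simp only [e1, Pi.mul_apply] at h
    have e3 : ∫⁻ z, k y z * f z ∂μ = ∫⁻ z, (k y z * ρ z) ^ (1 / 2 : ℝ) *
        (k y z * ((ρ z)⁻¹ * f z ^ (2 : ℝ))) ^ (1 / 2 : ℝ) ∂μ := by
      refine lintegral_congr_ae ?_
      filter_upwards [hρ0, hρt] with z h0 ht
      rw [← ENNReal.mul_rpow_of_nonneg _ _ (by norm_num)]
      have : k y z * ρ z * (k y z * ((ρ z)⁻¹ * f z ^ (2 : ℝ))) = (k y z * f z) ^ (2 : ℝ) := by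
        rw [ENNReal.mul_rpow_of_nonneg _ _ (by norm_num), ENNReal.rpow_two (k y z), pow_two]
        calc _ = (ρ z * (ρ z)⁻¹) * (k y z * k y z * f z ^ (2 : ℝ)) := by ring
          _ = _ := by rw [ENNReal.mul_inv_cancel h0 ht, one_mul]
      rw [this, e2]
    rw [← e3] at h
    calc _ ≤ _ := ENNReal.rpow_le_rpow h (by norm_num : (0 : ℝ) ≤ 2)
      _ = _ := by rw [ENNReal.mul_rpow_of_nonneg _ _ (by norm_num), e1, e1]
  calc ∫⁻ y, (∫⁻ z, k y z * f z ∂μ) ^ (2 : ℝ) ∂μ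
      ≤ ∫⁻ y, C * ρ y * ∫⁻ z, k y z * ((ρ z)⁻¹ * f z ^ (2 : ℝ)) ∂μ ∂μ := lintegral_mono_ae key
    _ = ∫⁻ y, ∫⁻ z, C * ρ y * (k y z * ((ρ z)⁻¹ * f z ^ (2 : ℝ))) ∂μ ∂μ := by
        refine lintegral_congr fun y => ?_
        have hm : Measurable fun z => k y z * ((ρ z)⁻¹ * f z ^ (2 : ℝ)) := (hky y).mul hg
        rw [lintegral_const_mul _ hm]
    _ = ∫⁻ z, ∫⁻ y, C * ρ y * (k y z * ((ρ z)⁻¹ * f z ^ (2 : ℝ))) ∂μ ∂μ := by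
        refine lintegral_lintegral_swap (Measurable.aemeasurable ?_)
        exact ((hρ.comp measurable_fst).const_mul C).mul (hk.mul (hg.comp measurable_snd))
    _ = ∫⁻ z, C ^ (2 : ℝ) * f z ^ (2 : ℝ) ∂μ := by
        refine lintegral_congr_ae ?_
        filter_upwards [H, hρ0, hρt] with z hz h0 ht
        calc ∫⁻ y, C * ρ y * (k y z * ((ρ z)⁻¹ * f z ^ (2 : ℝ))) ∂μ
            = ∫⁻ y, (C * ((ρ z)⁻¹ * f z ^ (2 : ℝ))) * (k z y * ρ y) ∂μ := by
              refine lintegral_congr fun y => ?_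
              rw [hsymm y z]
              ring
          _ = (C * ((ρ z)⁻¹ * f z ^ (2 : ℝ))) * (C * ρ z) := by
              have hm : Measurable fun y => k z y * ρ y := (hky z).mul hρ
              rw [lintegral_const_mul _ hm, hz]
          _ = (ρ z * (ρ z)⁻¹) * (C * C * f z ^ (2 : ℝ)) := by ring
          _ = _ := by rw [ENNReal.mul_inv_cancel h0 ht, one_mul, ENNReal.rpow_two C, pow_two]
    _ = _ := lintegral_const_mul _ (hf.pow_const _)

end SchurTest

/-! ### Boundedness of `K_N`. -/

section Bounded

variable {K : Type*} [NontriviallyNormedField K] [ProperSpace K]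
variable [MeasurableSpace K] [BorelSpace K] {μ : Measure K} [μ.IsAddHaarMeasure]

/-- By homogeneity `|z|^(-1/2)` is an eigenfunction of the absolute kernel, with eigenvalue the
convergent Mellin integral of `‖mulKernel N‖` at `1/2`. -/
lemma lintegral_logKernel_weight {N : ℕ} (hN : 1 ≤ N) : ∃ C : ℝ≥0, ∀ y : K, y ≠ 0 →
    ∫⁻ z, ‖(logKernel N y z : ℂ)‖ₑ * ENNReal.ofReal (modulus z ^ (-(1 / 2) : ℝ)) ∂μ =
      C * ENNReal.ofReal (modulus y ^ (-(1 / 2) : ℝ)) := by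
  have hI := (mellinStrip_mulKernel (μ := μ) (K := K) hN).2 (1 / 2) (by norm_num) (by norm_num)
  have hfin := hI.lintegral_lt_top
  refine ⟨(∫⁻ u, ENNReal.ofReal (modulus u ^ (-(1 / 2) : ℝ) * ‖mulKernel N u‖) ∂μ).toNNReal,
    fun y hy => ?_⟩
  rw [ENNReal.coe_toNNReal hfin.ne]
  have hy' := modulus_pos hy
  have h1 := lintegral_comp_mul μ (fun z => ‖(logKernel N y z : ℂ)‖ₑ *
    ENNReal.ofReal (modulus z ^ (-(1 / 2) : ℝ))) hy
  have h2 : ∫⁻ u, ‖(logKernel N y (y * u) : ℂ)‖ₑ *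
      ENNReal.ofReal (modulus (y * u) ^ (-(1 / 2) : ℝ)) ∂μ =
      ENNReal.ofReal (modulus y)⁻¹ * ((∫⁻ u, ENNReal.ofReal
        (modulus u ^ (-(1 / 2) : ℝ) * ‖mulKernel N u‖) ∂μ) *
          ENNReal.ofReal (modulus y ^ (-(1 / 2) : ℝ))) := by
    have hm : Measurable fun u : K => ENNReal.ofReal (modulus u ^ (-(1 / 2) : ℝ) * ‖mulKernel N u‖) :=
      ((continuous_modulus.measurable.pow_const _).mul (measurable_mulKernel N).norm).ennreal_ofReal
    rw [← lintegral_mul_const _ hm, ← lintegral_const_mul _ (hm.mul_const _)]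
    refine lintegral_congr_ae ?_
    filter_upwards [ae_ne_zero] with u hu
    have hu' := modulus_pos hu
    rw [logKernel_swap, modulus_mul, Real.mul_rpow hy'.le hu'.le, Complex.ofReal_mul,
      logKernel_mul N hy hu, ← ofReal_norm, ← ENNReal.ofReal_mul (norm_nonneg _),
      ← ENNReal.ofReal_mul (by positivity), ← ENNReal.ofReal_mul (by positivity)]
    congr 1
    rw [norm_mul, norm_mul, Complex.norm_real, Complex.norm_real, norm_pow, norm_neg, norm_one,
      one_pow, Real.norm_of_nonneg (inv_nonneg.2 hy'.le)]
    ring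
  rw [h2] at h1
  refine ((ENNReal.mul_right_inj ?_ ENNReal.ofReal_ne_top).1 h1).symm
  simpa using hy'

variable [hK : Fact (IsUltrametricDist K ∨ Nonempty (NormedAlgebra ℝ K))]
variable {e : AddChar K Circle}

lemma IsSchwartzBruhat.memLp_two {f : K → ℂ} (hf : IsSchwartzBruhat f) : MemLp f 2 μ := by
  obtain ⟨C, hC0, hC⟩ := hf.decay 0
  refine (memLp_two_iff_integrable_sq_norm hf.continuous.aestronglyMeasurable).2 ?_
  refine (hf.integrable.norm.const_mul C).mono
    (hf.continuous.norm.pow 2).aestronglyMeasurable (Eventually.of_forall fun y => ?_)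
  have h := hC y
  rw [pow_zero, one_mul] at h
  rw [Real.norm_of_nonneg (by positivity), Real.norm_of_nonneg (by positivity), pow_two]
  gcongr

lemma exists_bounded_commutator (he : Continuous e) (he' : e ≠ 1) {c : ℂ}
    (hc : IsLogConstant μ e c) {N : ℕ} (hN : 1 ≤ N) :
    ∃ T : Lp ℂ 2 μ →L[ℂ] Lp ℂ 2 μ, ∀ α : K → ℂ, IsPuncturedTest α →
      ∃ (hα : MemLp α 2 μ) (hKα : MemLp (commutator e μ N α) 2 μ),
        T (hα.toLp α) = hKα.toLp (commutator e μ N α) := by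
  obtain ⟨C, hC⟩ := lintegral_logKernel_weight (μ := μ) (K := K) hN
  have hk : Measurable (Function.uncurry fun y z : K => (logKernel N y z : ℂ)) :=
    Complex.measurable_ofReal.comp (measurable_logKernel N)
  obtain ⟨T, hT⟩ := exists_bounded_operator_of_kernel (μ := μ) hk (C := C) fun f hf => by
    simp only [enorm_mul]
    refine schur_test (k := fun y z : K => ‖(logKernel N y z : ℂ)‖ₑ) hk.enorm (fun y z => ?_)
      (ρ := fun z => ENNReal.ofReal (modulus z ^ (-(1 / 2) : ℝ)))
      (continuous_modulus.measurable.pow_const _).ennreal_ofReal ?_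
      (Eventually.of_forall fun _ => ENNReal.ofReal_ne_top) ?_ hf.measurable.enorm
    · rw [logKernel_swap N z y, ← ofReal_norm, ← ofReal_norm]
      simp
    · filter_upwards [ae_ne_zero] with z hz
      have := Real.rpow_pos_of_pos (modulus_pos hz) (-(1 / 2))
      simpa using this
    · filter_upwards [ae_ne_zero] with y hy using hC y hy
  refine ⟨c • T, fun α hα => ⟨hα.1.memLp_two, ?_⟩⟩
  obtain ⟨h1, h2⟩ := hT α hα.1.memLp_two
  have heq : commutator e μ N α = c • fun y => ∫ z, (logKernel N y z : ℂ) * α z ∂μ := by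
    ext y
    exact commutator_eq_kernel he he' hc hN hα y
  refine ⟨heq ▸ h1.const_smul c, ?_⟩
  rw [smul_apply, h2, ← MemLp.toLp_const_smul]
  exact MemLp.toLp_congr _ _ (Eventually.of_forall fun y => by rw [heq])

end Bounded

end LocalCommutator

end

noncomputable section

namespace LocalCommutator

open Filter Set
open scoped ENNReal NNReal Pointwise ContDiff

variable {K : Type*} [NontriviallyNormedField K] [ProperSpace K]
variable [MeasurableSpace K] [BorelSpace K] {μ : Measure K} [μ.IsAddHaarMeasure]
variable [hK : Fact (IsUltrametricDist K ∨ Nonempty (NormedAlgebra ℝ K))]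
variable {e : AddChar K Circle} (χ : Kˣ →ₜ* Circle) {s : ℂ}

/-! ### Logarithmic derivatives of the Gamma function. -/

section LogDerivative

lemma continuous_opB (he : Continuous e) (he' : e ≠ 1) {f : K → ℂ} (hf : IsSchwartzBruhat f) :
    Continuous (opB e μ f) :=
  (continuous_fourierIntegral he (hf.fourier μ he he').integrable_opA).comp continuous_neg

/-- `B f` is bounded, being the transform of an integrable function. Beyond twice the radius of the
support of `f` the kernel formula applies, with `|z - y|` comparable to `|y|`, and gives decay like
`1 / |y|`. -/
lemma mellinStrip_opB (he : Continuous e) (he' : e ≠ 1) {c : ℂ} (hc : IsLogConstant μ e c)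
    {f : K → ℂ} (hf : IsSchwartzBruhat f) (hfc : HasCompactSupport f) :
    MellinStrip μ (opB e μ f) 0 1 := by
  obtain ⟨d, hd, hn⟩ := exists_modulus_eq_norm_rpow K
  obtain ⟨R, hR0, hR⟩ := hfc.isCompact.isBounded.exists_pos_norm_le
  have hR' : ∀ z, R < ‖z‖ → f z = 0 := fun z hz =>
    image_eq_zero_of_notMem_tsupport fun h => hz.not_ge (hR z h)
  set C₁ := ∫ x, ‖opA (Fourier.fourierIntegral e μ f) x‖ ∂μ with hC₁
  set C₂ := ‖c‖ * ∫ z, ‖f z‖ * 2 ^ d ∂μ with hC₂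
  have hC₁0 : 0 ≤ C₁ := integral_nonneg fun _ => norm_nonneg _
  have hC₂0 : 0 ≤ C₂ := mul_nonneg (norm_nonneg _) (integral_nonneg fun _ => by positivity)
  have hb : ∀ y, ‖opB e μ f y‖ ≤ C₁ := fun y =>
    Fourier.norm_fourierIntegral_le_integral_norm e μ _ _
  have := MellinStrip.of_bounds (μ := μ) (α := 0) (β := 1) (C := C₁ + C₁ * (2 * R) ^ d + C₂)
    (continuous_opB (μ := μ) he he' hf).aestronglyMeasurable (fun y hy => ?_) (fun y hy => ?_)
  · simpa using this
  · rw [neg_zero, Real.rpow_zero, mul_one]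
    have : 0 ≤ C₁ * (2 * R) ^ d := by positivity
    linarith [hb y]
  · have hy' := modulus_pos hy
    rw [Real.rpow_neg_one, ← div_eq_mul_inv, le_div_iff₀ hy']
    rcases le_or_gt ‖y‖ (2 * R) with h | h
    · have h1 : modulus y ≤ (2 * R) ^ d := by
        rw [hn]; exact Real.rpow_le_rpow (norm_nonneg _) h hd.le
      have : ‖opB e μ f y‖ * modulus y ≤ C₁ * (2 * R) ^ d := by
        gcongr
        exact hb y
      linarith
    · rw [opB_eq_kernel hc hf (hR' y (by linarith)), norm_mul]
      have h1 : ‖∫ z, f z * (((modulus (z - y))⁻¹ : ℝ) : ℂ) ∂μ‖ ≤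
          ∫ z, ‖f z‖ * 2 ^ d * (modulus y)⁻¹ ∂μ := by
        refine norm_integral_le_of_norm_le ((hf.integrable.norm.mul_const _).mul_const _)
          (Eventually.of_forall fun z => ?_)
        rcases le_or_gt ‖z‖ R with hz | hz
        · rw [norm_mul, Complex.norm_real, Real.norm_of_nonneg (inv_nonneg.2 (modulus_nonneg _)),
            mul_assoc]
          gcongr
          have hyz : ‖y‖ ≤ 2 * ‖z - y‖ := by
            have : ‖y‖ ≤ ‖z‖ + ‖z - y‖ := by simpa using norm_sub_le z (z - y)
            linarith
          have hy0 := norm_pos_iff.2 hy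
          rw [← div_eq_mul_inv, le_div_iff₀ hy', inv_mul_le_iff₀, hn, hn,
            ← Real.mul_rpow (by positivity) (by positivity)]
          · exact Real.rpow_le_rpow (norm_nonneg _) (by linarith) hd.le
          · exact modulus_pos (norm_pos_iff.1 (by linarith))
        · rw [hR' z hz]
          simp
      rw [integral_mul_const] at h1
      have h2 : ‖c‖ * ‖∫ z, f z * (((modulus (z - y))⁻¹ : ℝ) : ℂ) ∂μ‖ * modulus y ≤ C₂ := by
        calc _ ≤ ‖c‖ * ((∫ z, ‖f z‖ * 2 ^ d ∂μ) * (modulus y)⁻¹) * modulus y := by gcongr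
          _ = C₂ := by rw [hC₂, mul_assoc, mul_assoc, inv_mul_cancel₀ hy'.ne', mul_one]
      have : 0 ≤ C₁ * (2 * R) ^ d := by positivity
      linarith

lemma mellinStrip_conductor (he : Continuous e) (he' : e ≠ 1) {c : ℂ} (hc : IsLogConstant μ e c)
    {f : K → ℂ} (hf : IsSchwartzBruhat f) (hfc : HasCompactSupport f) :
    MellinStrip μ (conductor e μ f) 0 1 :=
  (hf.mellinStrip 0).opA.add (mellinStrip_opB he he' hc hf hfc)

lemma mellinChar_add {f g : K → ℂ} {a b : ℝ} (hf : MellinStrip μ f a b) (hg : MellinStrip μ g a b)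
    (hs : a < s.re) (hs' : s.re < b) :
    mellinChar μ χ (fun y => f y + g y) s = mellinChar μ χ f s + mellinChar μ χ g s := by
  simp only [mellinChar, add_mul]
  exact integral_add (hf.integrable_mul χ hs hs') (hg.integrable_mul χ hs hs')

lemma mellinChar_sub {f g : K → ℂ} {a b : ℝ} (hf : MellinStrip μ f a b) (hg : MellinStrip μ g a b)
    (hs : a < s.re) (hs' : s.re < b) :
    mellinChar μ χ (fun y => f y - g y) s = mellinChar μ χ f s - mellinChar μ χ g s := by
  simp only [mellinChar, sub_mul]
  exact integral_sub (hf.integrable_mul χ hs hs') (hg.integrable_mul χ hs hs')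

/-- The functional equation for `B f`, whose Fourier transform is formally `log |x|` times that of
`f`. Since `B f` need not be Schwartz–Bruhat, the symmetric form is used against an auxiliary `g`.
-/
lemma mellinChar_opA_fourier (he : Continuous e) (he' : e ≠ 1) (hμ : IsSelfDual e μ) {c : ℂ}
    (hc : IsLogConstant μ e c) (hs : 0 < s.re) (hs' : s.re < 1) {f : K → ℂ}
    (hf : IsSchwartzBruhat f) (hfc : HasCompactSupport f) :
    mellinChar μ χ⁻¹ (opA (Fourier.fourierIntegral e μ f)) (1 - s) =
      tateGamma e μ χ s * mellinChar μ χ (opB e μ f) s := by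
  obtain ⟨g, hg, -, hg0⟩ := exists_mellinChar_ne_zero μ χ hs'.le
  have hf' := hf.fourier μ he he'
  have h := mellinChar_fourier_symm he he' hμ χ hs hs' hg.1
    (measurable_opA hf'.continuous.measurable) hf'.integrable_opA
    ((hf'.mellinStrip 0).opA.integrable_mul _ (one_sub_re_mem hs hs').1 (one_sub_re_mem hs hs').2)
    ((mellinStrip_opB he he' hc hf hfc).integrable_mul χ hs hs')
  rw [mellinChar_fourier χ he he' hμ hs hs' hg.1] at h
  refine mul_left_cancel₀ hg0 (h.trans ?_)
  change mellinChar μ χ (opB e μ f) s * _ = _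
  ring

lemma differentiableAt_tateGamma (he : Continuous e) (he' : e ≠ 1) (hμ : IsSelfDual e μ)
    (hs : 0 < s.re) (hs' : s.re < 1) : DifferentiableAt ℂ (tateGamma e μ χ) s :=
  (differentiableOn_tateGamma χ he he' hμ).differentiableAt (isOpen_strip.mem_nhds ⟨hs, hs'⟩)

/-- The conductor operator acts on `χ⁻¹(y) |y|^(-s)` by the logarithmic derivative of `Γ`. -/
lemma logDeriv_mul_mellinChar (he : Continuous e) (he' : e ≠ 1) (hμ : IsSelfDual e μ) {c : ℂ}
    (hc : IsLogConstant μ e c) (hs : 0 < s.re) (hs' : s.re < 1) {f : K → ℂ}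
    (hf : IsSchwartzBruhat f) (hfc : HasCompactSupport f) :
    logDeriv (tateGamma e μ χ) s * mellinChar μ χ f s = mellinChar μ χ (conductor e μ f) s := by
  -- Differentiating `M(f̃, 1 - s) = Γ(s) M(f, s)` gives `M(A f̃, 1 - s) = Γ' M(f) - Γ M(A f)`, and
  -- the left side is `Γ M(B f)`.
  have h1 := hasDerivAt_mellinChar_one_sub χ⁻¹ ((hf.fourier μ he he').mellinStrip (μ := μ) 0)
    (one_sub_re_mem hs hs').1 (one_sub_re_mem hs hs').2
  have h2 := (differentiableAt_tateGamma χ he he' hμ hs hs').hasDerivAt.mul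
    ((hf.mellinStrip (μ := μ) 0).hasDerivAt χ hs hs')
  have h3 := (h2.congr_of_eventuallyEq (f₁ := fun z =>
    mellinChar μ χ⁻¹ (Fourier.fourierIntegral e μ f) (1 - z)) (by
      filter_upwards [isOpen_strip.mem_nhds ⟨hs, hs'⟩] with z hz
      exact mellinChar_fourier χ he he' hμ hz.1 hz.2 hf)).unique h1
  rw [mellinChar_opA_fourier χ he he' hμ hc hs hs' hf hfc] at h3
  have h4 : mellinChar μ χ (conductor e μ f) s =
      mellinChar μ χ (opA f) s + mellinChar μ χ (opB e μ f) s :=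
    mellinChar_add χ (hf.mellinStrip 0).opA (mellinStrip_opB he he' hc hf hfc) hs hs'
  have h5 := tateGamma_ne_zero χ he he' hμ hs hs'
  rw [h4, logDeriv_apply, div_mul_eq_mul_div, div_eq_iff h5]
  linear_combination h3

/-- Differentiating `(Γ'/Γ) M(f) = M(H f)` gives `(Γ'/Γ)' M(f) = (Γ'/Γ) M(A f) - M(A H f)`. As
`(Γ'/Γ) M(A f) = M(H A f)`, the right side is `-M([A, H] f)`, which the kernel formula evaluates. -/
lemma hasDerivAt_logDeriv_tateGamma (he : Continuous e) (he' : e ≠ 1) (hμ : IsSelfDual e μ) {c : ℂ}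
    (hc : IsLogConstant μ e c) (hs : 0 < s.re) (hs' : s.re < 1) :
    HasDerivAt (logDeriv (tateGamma e μ χ)) (-(c * mellinChar μ χ (mulKernel 1) s)) s := by
  obtain ⟨f, hf, hfc, hf0⟩ := exists_mellinChar_ne_zero μ χ hs'.le
  have hAc : HasCompactSupport (opA f) := hfc.mul_left
  have hd : DifferentiableAt ℂ (logDeriv (tateGamma e μ χ)) s :=
    (((differentiableOn_tateGamma χ he he' hμ).deriv isOpen_strip).differentiableAt
      (isOpen_strip.mem_nhds ⟨hs, hs'⟩)).div (differentiableAt_tateGamma χ he he' hμ hs hs')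
        (tateGamma_ne_zero χ he he' hμ hs hs')
  have hH := mellinStrip_conductor he he' hc hf.1 hfc
  have hHA := mellinStrip_conductor he he' hc hf.opA.1 hAc
  have h1 := hd.hasDerivAt.mul ((hf.1.mellinStrip (μ := μ) 0).hasDerivAt χ hs hs')
  have h2 := (hH.hasDerivAt χ hs hs').congr_of_eventuallyEq
    (f₁ := logDeriv (tateGamma e μ χ) * mellinChar μ χ f) (by
      filter_upwards [isOpen_strip.mem_nhds ⟨hs, hs'⟩] with z hz
      exact logDeriv_mul_mellinChar χ he he' hμ hc hz.1 hz.2 hf.1 hfc)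
  have h3 := h1.unique h2
  have h4 := logDeriv_mul_mellinChar χ he he' hμ hc hs hs' hf.opA.1 hAc
  have h5 : mellinChar μ χ (opA (conductor e μ f)) s - mellinChar μ χ (conductor e μ (opA f)) s =
      c * mellinChar μ χ (mulKernel 1) s * mellinChar μ χ f s := by
    rw [← mellinChar_sub χ hH.opA hHA hs hs',
      ← pairing_homogeneous_commutator χ he he' hc le_rfl hf hs hs']
    refine integral_congr_ae (Eventually.of_forall fun y => ?_)
    exact mul_comm _ _
  have h6 : deriv (logDeriv (tateGamma e μ χ)) s = -(c * mellinChar μ χ (mulKernel 1) s) := by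
    refine mul_right_cancel₀ hf0 ?_
    linear_combination h3 + h4 - h5
  exact h6 ▸ hd.hasDerivAt

/-- Each derivative of the Mellin transform inserts a factor `-log |u|`, turning `mulKernel N` into
`-mulKernel (N + 1)`. -/
lemma iteratedDeriv_logDeriv_tateGamma (he : Continuous e) (he' : e ≠ 1) (hμ : IsSelfDual e μ)
    {c : ℂ} (hc : IsLogConstant μ e c) {N : ℕ} (hN : 1 ≤ N) (hs : 0 < s.re) (hs' : s.re < 1) :
    iteratedDeriv N (logDeriv (tateGamma e μ χ)) s =
      (-1) ^ N * (c * mellinChar μ χ (mulKernel N) s) := by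
  induction N, hN using Nat.le_induction generalizing s with
  | base =>
    rw [iteratedDeriv_one, (hasDerivAt_logDeriv_tateGamma χ he he' hμ hc hs hs').deriv]
    ring
  | succ N hN ih =>
    rw [iteratedDeriv_succ]
    have h1 : iteratedDeriv N (logDeriv (tateGamma e μ χ)) =ᶠ[𝓝 s] fun z =>
        (-1) ^ N * (c * mellinChar μ χ (mulKernel N) z) := by
      filter_upwards [isOpen_strip.mem_nhds ⟨hs, hs'⟩] with z hz
      exact ih hz.1 hz.2
    have h2 := (((mellinStrip_mulKernel (μ := μ) hN).hasDerivAt χ hs hs').const_mul c).const_mul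
      ((-1 : ℂ) ^ N)
    rw [h1.deriv_eq, h2.deriv, opA_mulKernel]
    ring

end LogDerivative

end LocalCommutator

end

open LocalCommutator in
theorem mainTheorem5 {K : Type*} [NontriviallyNormedField K] [LocallyCompactSpace K] [CharZero K]
    [MeasurableSpace K] [BorelSpace K]
    (hK : IsUltrametricDist K ∨ Nonempty (NormedAlgebra ℝ K))
    (e : AddChar K Circle) (he : Continuous e) (he' : e ≠ 1)
    (μ : Measure K) [μ.IsAddHaarMeasure] (hμ : IsSelfDual e μ) :
    -- the Gamma function is given by the functional equation in the critical strip,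
    -- where it is analytic and has no zero, so that its logarithm has derivatives
    (∀ χ : Kˣ →ₜ* Circle,
      DifferentiableOn ℂ (tateGamma e μ χ) {s | 0 < s.re ∧ s.re < 1} ∧
      ∀ s : ℂ, 0 < s.re → s.re < 1 →
        (∀ γ : ℂ, IsTateGamma e μ χ s γ ↔ γ = tateGamma e μ χ s) ∧ tateGamma e μ χ s ≠ 0) ∧
    ∀ N : ℕ, 1 ≤ N →
      -- transposition, which defines `K_N` on distributions
      (∀ α₁ α₂ : K → ℂ, IsPuncturedTest α₁ → IsPuncturedTest α₂ →
        pairing μ (commutator e μ N α₁) α₂ = (-1) ^ N * pairing μ α₁ (commutator e μ N α₂)) ∧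
      -- the identity of distributions on the punctured line
      (∀ (χ : Kˣ →ₜ* Circle) (s : ℂ), 0 < s.re → s.re < 1 →
        ∀ α : K → ℂ, IsPuncturedTest α →
          Integrable (fun y => homogeneous χ s y * commutator e μ N α y) μ ∧
          commutatorDist e μ N (homogeneous χ s) α =
            iteratedDeriv N (logDeriv (tateGamma e μ χ)) s * pairing μ (homogeneous χ s) α) ∧
      -- `K_N` is bounded on `L²(K, dy)`
      (∃ T : Lp ℂ 2 μ →L[ℂ] Lp ℂ 2 μ, ∀ α : K → ℂ, IsPuncturedTest α →
        ∃ (hα : MemLp α 2 μ) (hKα : MemLp (commutator e μ N α) 2 μ),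
          T (hα.toLp α) = hKα.toLp (commutator e μ N α)) := by
  have : ProperSpace K := ProperSpace.of_locallyCompactSpace K
  have : Fact (IsUltrametricDist K ∨ Nonempty (NormedAlgebra ℝ K)) := ⟨hK⟩
  obtain ⟨c, hc'⟩ := exists_integral_log_fourier he he' hμ
  have hc : IsLogConstant μ e c := ⟨hc'⟩
  refine ⟨fun χ => ⟨differentiableOn_tateGamma χ he he' hμ, fun s hs hs' =>
    ⟨isTateGamma_iff_eq_tateGamma χ he he' hμ hs hs', tateGamma_ne_zero χ he he' hμ hs hs'⟩⟩,
    fun N hN => ⟨fun α₁ α₂ h₁ h₂ => pairing_commutator_transpose he he' hc hN h₁ h₂,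
      fun χ s hs hs' α hα =>
        ⟨integrable_homogeneous_mul_commutator χ he he' hc hN hα hs hs', ?_⟩,
      exists_bounded_commutator he he' hc hN⟩⟩
  have h1 : pairing μ (homogeneous χ s) α = mellinChar μ χ α s :=
    integral_congr_ae (.of_forall fun y => mul_comm _ _)
  rw [commutatorDist, pairing_homogeneous_commutator χ he he' hc hN hα hs hs',
    iteratedDeriv_logDeriv_tateGamma χ he he' hμ hc hN hs hs', h1]
  ring
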